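/- Let $\mathbb K\in\{\mathbb R,\mathbb C\}$, let $\Omega\subseteq\mathbb R^3$ be open, and write $L_2(\Omega)$, $L_2(\Omega)^3$ for the $\mathbb K$-valued Lebesgue spaces (scalar products linear in the second argument). Operators. $\mathring{\operatorname{grad}}$ is the gradient with domain $H^1_0(\Omega)$, $\operatorname{div}=-\mathring{\operatorname{grad}}{}^*$, $\operatorname{curl}$ is the distributional rotation in $L_2(\Omega)^3$ with its maximal domain, $\mathring{\operatorname{curl}}=\operatorname{curl}^*$, and $\mathcal H_D(\Omega)=\ker(\operatorname{div})\cap\ker(\mathring{\operatorname{curl}})$, with orthogonal projection $\pi_D$. Let $H^{-1}(\Omega)$ be the dual of $H^1_0(\Omega)$ and $H^{-1}(\operatorname{curl}_{\rm red})$ the dual of $H^1(\operatorname{curl}_{\rm red})=\operatorname{dom}(\operatorname{curl})\cap\ker(\operatorname{curl})^\perp$ (each with graph norm). For $\Phi\in L_2(\Omega)^3$ let $\operatorname{div}\Phi\in H^{-1}(\Omega)$ be the functional $u\mapsto-\langle\Phi,\mathring{\operatorname{grad}}\,u\rangle$ and $\operatorname{curl}^\diamond\Phi\in H^{-1}(\operatorname{curl}_{\rm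 red})$ the functional $v\mapsto\langle\Phi,\operatorname{curl}v\rangle$. Assume that $\Omega$ has the electric compactness property: $\operatorname{dom}(\operatorname{div})\cap\operatorname{dom}(\mathring{\operatorname{curl}})$, with its graph norm, embeds compactly into $L_2(\Omega)^3$ (then $\operatorname{ran}(\mathring{\operatorname{grad}})$ and $\operatorname{ran}(\operatorname{curl})$ are closed). Coefficients. A bounded operator $\varepsilon$ on $L_2(\Omega)^3$ is admissible if $\varepsilon$, $\iota^*\varepsilon\iota$ and $\kappa^*\varepsilon^{-1}\kappa$ are boundedly invertible, where $\iota$, $\kappa$ are the embeddings of $\operatorname{ran}(\mathring{\operatorname{grad}})$, $\operatorname{ran}(\operatorname{curl})$ into $L_2(\Omega)^3$. For such $\varepsilon$ let $\mathcal H_\varepsilon=\ker(\operatorname{div}\varepsilon)\cap\ker(\mathring{\operatorname{curl}})$, and let $\pi_\varepsilon$ be the projection onto $\mathcal H_\varepsilon$ along the other two summands of the direct decomposition $L_2(\Omega)^3=\operatorname{ran}(\mathring{\operatorname{grad}})\dotplus\varepsilon^{-1}\operatorname{ran}(\operatorname{curl})\dotplus\mathcal H_\varepsilon$. Topology. Let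 $\mathcal H_0=\operatorname{ran}(\mathring{\operatorname{grad}})$, $\mathcal H_1=\mathcal H_0^\perp$, and write bounded operators $a$ on $L_2(\Omega)^3$ as block operators $(a_{jk})_{j,k\in\{0,1\}}$ with respect to $\mathcal H_0\oplus\mathcal H_1$. On the set $\mathcal M$ of those $a$ for which $a$ and $a_{00}$ are boundedly invertible, let $\tau$ be the initial topology of the maps $a\mapsto a_{00}^{-1}$, $a_{00}^{-1}a_{01}$, $a_{10}a_{00}^{-1}$, $a_{11}-a_{10}a_{00}^{-1}a_{01}$ into the respective operator spaces with their weak operator topologies, and let $\tau_{\rm bH}$ be the finest topology on $\mathcal M$ for which, for every $\lambda>0$, the inclusion into $\mathcal M$ of the set of those $a\in\mathcal M$ for which the four operators have norm at most $\lambda$, endowed with the relative topology of $\tau$, is continuous. Theorem. Let $\varepsilon_n$ $(n\in\mathbb N)$ and $\varepsilon$ be admissible with $\varepsilon_n\to\varepsilon$ in $\tau_{\rm bH}$. Let $f_n\to f$ in $H^{-1}(\Omega)$, $g_n\to g$ in $H^{-1}(\operatorname{curl}_{\rm red})$ and $x_n\to x$ in $\mathcal H_D(\Omega)$, all in norm,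 and let $E_n\in L_2(\Omega)^3$ satisfy $$\operatorname{div}\varepsilon_nE_n=f_n,\qquad \operatorname{curl}^\diamond E_n=g_n,\qquad \pi_D\pi_{\varepsilon_n}E_n=x_n .$$ Then the limit problem $$\operatorname{div}\varepsilon E=f,\qquad \operatorname{curl}^\diamond E=g,\qquad \pi_D\pi_{\varepsilon}E=x$$ has a unique solution $E\in L_2(\Omega)^3$, and $E_n\rightharpoonup E$ and $\varepsilon_nE_n\rightharpoonup\varepsilon E$ weakly in $L_2(\Omega)^3$ and $\langle\varepsilon_nE_n,E_n\rangle\to\langle\varepsilon E,E\rangle$. -/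

import Mathlib

open MeasureTheory Filter Topology TopologicalSpace InnerProductSpace
open scoped LinearPMap Distributions

noncomputable section

/-! ### Generalities on unbounded operators -/

namespace Electro

section Abstract

variable {𝕜 X Y : Type*} [RCLike 𝕜]
  [NormedAddCommGroup X] [InnerProductSpace 𝕜 X]
  [NormedAddCommGroup Y] [InnerProductSpace 𝕜 Y]

/-- The range of an unbounded operator. -/
def ran (C : X →ₗ.[𝕜] Y) : Submodule 𝕜 Y := LinearMap.range C.toFun

/-- The kernel of an unbounded operator, as a subspace of the ambient space. -/
def ker (C : X →ₗ.[𝕜] Y) : Submodule 𝕜 X := (LinearMap.ker C.toFun).map C.domain.subtype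

/-- `H¹(C)`: the domain of `C` with the graph inner product
`⟪u, v⟫ + ⟪C u, C v⟫`, realised isometrically as the graph `{(u, C u)}` inside the Hilbert sum of
the two spaces. -/
def H1 (C : X →ₗ.[𝕜] Y) : Submodule 𝕜 (WithLp 2 (X × Y)) :=
  C.graph.comap (WithLp.linearEquiv 2 𝕜 (X × Y)).toLinearMap

/-- `H⁻¹(C)`: the dual of `H¹(C)`, with the dual norm. -/
abbrev Hneg1 (C : X →ₗ.[𝕜] Y) : Type _ := StrongDual 𝕜 (H1 C)

/-- `C^⋄ : Y → H⁻¹(C)`, `C^⋄ Φ = (u ↦ ⟪Φ, C u⟫)`; the pairing is antilinear in `Φ`. -/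
def diamond (C : X →ₗ.[𝕜] Y) (Φ : Y) : Hneg1 C :=
  (innerSL 𝕜 Φ).comp ((WithLp.sndL 2 𝕜 X Y).comp (H1 C).subtypeL)

/-- The restriction of `C` to `dom C ∩ (ker C)ᗮ`.  It has the same domain, graph norm and values as
the reduced operator `C_red : (ker C)ᗮ → ran C`. -/
def reduced (C : X →ₗ.[𝕜] Y) : X →ₗ.[𝕜] Y := C.domRestrict (ker C)ᗮ

theorem mem_ran {C : X →ₗ.[𝕜] Y} {y : Y} : y ∈ ran C ↔ ∃ x : C.domain, C x = y := Iff.rfl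

theorem mem_ker {C : X →ₗ.[𝕜] Y} {x : X} : x ∈ ker C ↔ ∃ h : x ∈ C.domain, C ⟨x, h⟩ = 0 := by
  simp only [ker, Submodule.mem_map, LinearMap.mem_ker]
  constructor
  · rintro ⟨y, hy, rfl⟩
    exact ⟨y.2, hy⟩
  · rintro ⟨h, hx⟩
    exact ⟨⟨x, h⟩, hx, rfl⟩

theorem mem_H1 {C : X →ₗ.[𝕜] Y} {p : WithLp 2 (X × Y)} :
    p ∈ H1 C ↔ ∃ h : p.fst ∈ C.domain, C ⟨p.fst, h⟩ = p.snd := by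
  change (p.fst, p.snd) ∈ C.graph ↔ _
  rw [LinearPMap.mem_graph_iff]
  constructor
  · rintro ⟨y, h1, h2⟩
    simp only at h1 h2
    have h : p.fst ∈ C.domain := h1 ▸ y.2
    refine ⟨h, ?_⟩
    rw [← h2]
    congr 1
    exact Subtype.ext h1.symm
  · rintro ⟨h, h2⟩
    exact ⟨⟨p.fst, h⟩, rfl, h2⟩

theorem diamond_apply (C : X →ₗ.[𝕜] Y) (Φ : Y) (u : H1 C) :
    diamond C Φ u = inner 𝕜 Φ (u : WithLp 2 (X × Y)).snd := rfl

/-- The kernel of the adjoint is the orthogonal complement of the range. -/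
theorem ker_adjoint [CompleteSpace X] {C : X →ₗ.[𝕜] Y} (hC : Dense (C.domain : Set X)) :
    ker C† = (ran C)ᗮ := by
  ext y
  rw [mem_ker, Submodule.mem_orthogonal']
  constructor
  · rintro ⟨h, h0⟩ _ ⟨x, rfl⟩
    have := LinearPMap.adjoint_isFormalAdjoint hC ⟨y, h⟩ x
    rw [h0, inner_zero_left] at this
    exact this.symm
  · intro h
    have hy : ∀ x : C.domain, inner 𝕜 (0 : X) (x : X) = inner 𝕜 y (C x) := fun x => by
      rw [inner_zero_left]
      exact (h _ ⟨x, rfl⟩).symm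
    have hm := LinearPMap.mem_adjoint_domain_of_exists (T := C) y ⟨0, hy⟩
    exact ⟨hm, LinearPMap.adjoint_apply_eq hC ⟨y, hm⟩ hy⟩

end Abstract

/-! ### The nonlocal `H`-topology -/

section Schur

variable {𝕜 X : Type*} [RCLike 𝕜]
  [NormedAddCommGroup X] [InnerProductSpace 𝕜 X] [CompleteSpace X]

/-- For closed subspaces `V`, `W` with inclusions `ι_V`, `ι_W`: the block `ι_W^* a ι_V : V → W` of a
bounded operator `a`. -/
def block (V W : Submodule 𝕜 X) [W.HasOrthogonalProjection] (a : X →L[𝕜] X) : V →L[𝕜] W :=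
  W.orthogonalProjectionOnto.comp (a.comp V.subtypeL)

variable (H0 : Submodule 𝕜 X) [H0.HasOrthogonalProjection]

/-- `a₀₀⁻¹` with respect to `H0 ⊕ H0ᗮ`. -/
def s00 (a : X →L[𝕜] X) : H0 →L[𝕜] H0 :=
  Ring.inverse (block H0 H0 a)

/-- `a₀₀⁻¹ a₀₁`. -/
def s01 (a : X →L[𝕜] X) : H0ᗮ →L[𝕜] H0 :=
  (s00 H0 a).comp (block H0ᗮ H0 a)

/-- `a₁₀ a₀₀⁻¹`. -/
def s10 (a : X →L[𝕜] X) : H0 →L[𝕜] H0ᗮ :=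
  (block H0 H0ᗮ a).comp (s00 H0 a)

/-- The Schur complement `a₁₁ - a₁₀ a₀₀⁻¹ a₀₁`. -/
def s11 (a : X →L[𝕜] X) : H0ᗮ →L[𝕜] H0ᗮ :=
  block H0ᗮ H0ᗮ a - (block H0 H0ᗮ a).comp ((s00 H0 a).comp (block H0ᗮ H0 a))

/-- The set `M(H0, H0ᗮ)` of invertible operators with invertible block `a₀₀`. -/
def MSet : Set (X →L[𝕜] X) := {a | IsUnit (block H0 H0 a) ∧ IsUnit a}

/-- The topology `τ(H0, H0ᗮ)` on `M(H0, H0ᗮ)`: the initial topology of the four maps, the target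
spaces carrying their weak operator topologies. -/
abbrev tau : TopologicalSpace (MSet H0) :=
  .induced (fun a => ContinuousLinearMapWOT.ofCLM (s00 H0 a.1)) inferInstance ⊓
  .induced (fun a => ContinuousLinearMapWOT.ofCLM (s01 H0 a.1)) inferInstance ⊓
  .induced (fun a => ContinuousLinearMapWOT.ofCLM (s10 H0 a.1)) inferInstance ⊓
  .induced (fun a => ContinuousLinearMapWOT.ofCLM (s11 H0 a.1)) inferInstance

/-- The operators in `M(H0, H0ᗮ)` with bound at most `r`. -/
def MBall (r : ℝ) : Set (MSet H0) :=
  {a | ‖s00 H0 a.1‖ ≤ r ∧ ‖s01 H0 a.1‖ ≤ r ∧ ‖s10 H0 a.1‖ ≤ r ∧ ‖s11 H0 a.1‖ ≤ r}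

/-- The topology `τ_b(H0, H0ᗮ)` of bounded nonlocal `H`-convergence: the finest topology on
`M(H0, H0ᗮ)` for which, for every `r > 0`, the inclusion of the ball of radius `r`, endowed with the
relative topology of `τ(H0, H0ᗮ)`, is continuous. -/
abbrev tauB : TopologicalSpace (MSet H0) :=
  ⨆ (r : ℝ) (_ : 0 < r),
    .coinduced (Subtype.val : MBall H0 r → MSet H0) (.induced Subtype.val (tau H0))

end Schur

/-! ### The differential operators -/

/-- Euclidean three-space. -/
abbrev R3 : Type := EuclideanSpace ℝ (Fin 3)

/-- The values of vector fields. -/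
abbrev Vec (𝕜 : Type*) : Type _ := EuclideanSpace 𝕜 (Fin 3)

variable (𝕜 : Type*) [RCLike 𝕜] (Ω : Opens R3)

/-- `L₂(Ω)`. -/
abbrev L2S : Type _ := Lp 𝕜 2 (volume.restrict (Ω : Set R3))

/-- `L₂(Ω)³`. -/
abbrev L2V : Type _ := Lp (Vec 𝕜) 2 (volume.restrict (Ω : Set R3))

/-- The `i`-th unit vector. -/
def e (i : Fin 3) : R3 := EuclideanSpace.single i 1

section Test

variable {𝕜 Ω}

/-- The partial derivative `∂ᵢ u`. -/
def pd {F : Type*} [NormedAddCommGroup F] [NormedSpace ℝ F] (i : Fin 3) (u : R3 → F) (x : R3) : F :=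
  fderiv ℝ u x (e i)

/-- The classical gradient of a function. -/
def gradFun (u : R3 → 𝕜) (x : R3) : Vec 𝕜 := !₂[pd 0 u x, pd 1 u x, pd 2 u x]

/-- The classical divergence of a vector field. -/
def divFun (v : R3 → Vec 𝕜) (x : R3) : 𝕜 :=
  pd 0 (fun y => v y 0) x + pd 1 (fun y => v y 1) x + pd 2 (fun y => v y 2) x

/-- The classical rotation of a vector field. -/
def curlFun (v : R3 → Vec 𝕜) (x : R3) : Vec 𝕜 :=
  !₂[pd 1 (fun y => v y 2) x - pd 2 (fun y => v y 1) x,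
     pd 2 (fun y => v y 0) x - pd 0 (fun y => v y 2) x,
     pd 0 (fun y => v y 1) x - pd 1 (fun y => v y 0) x]


theorem pd_add {F : Type*} [NormedAddCommGroup F] [NormedSpace ℝ F] (i : Fin 3) {u v : R3 → F}
    (hu : ContDiff ℝ (⊤ : ℕ∞) u) (hv : ContDiff ℝ (⊤ : ℕ∞) v) (x : R3) :
    pd i (u + v) x = pd i u x + pd i v x := by
  have h1 := (hu.differentiable (by simp)) x
  have h2 := (hv.differentiable (by simp)) x
  simp [pd, fderiv_add h1 h2]

theorem pd_smul (i : Fin 3) {u : R3 → 𝕜}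
    (hu : ContDiff ℝ (⊤ : ℕ∞) u) (c : 𝕜) (x : R3) : pd i (c • u) x = c * pd i u x := by
  have h1 := (hu.differentiable (by simp)) x
  simp [pd, fderiv_const_smul h1 c]

theorem contDiff_pd {F : Type*} [NormedAddCommGroup F] [NormedSpace ℝ F] (i : Fin 3) {u : R3 → F}
    (hu : ContDiff ℝ (⊤ : ℕ∞) u) : ContDiff ℝ (⊤ : ℕ∞) (pd i u) := by
  unfold pd
  exact (hu.fderiv_right (m := ((⊤ : ℕ∞) : WithTop ℕ∞)) (by simp)).clm_apply contDiff_const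

theorem contDiff_coord {v : R3 → Vec 𝕜} (hv : ContDiff ℝ (⊤ : ℕ∞) v) (i : Fin 3) :
    ContDiff ℝ (⊤ : ℕ∞) (fun x => v x i) :=
  (contDiff_piLp 2).1 hv i

theorem pd_eq_zero {F : Type*} [NormedAddCommGroup F] [NormedSpace ℝ F] (i : Fin 3) {u : R3 → F}
    {x : R3} (hx : x ∉ tsupport u) : pd i u x = 0 := by
  have : fderiv ℝ u x = 0 := by
    by_contra h
    exact hx (support_fderiv_subset ℝ h)
  simp [pd, this]

/-- A smooth function that vanishes off the support of a test function is a test function. -/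
def mkTest {F G : Type*} [NormedAddCommGroup F] [NormedSpace ℝ F] [NormedAddCommGroup G]
    [NormedSpace ℝ G] (u : 𝓓(Ω, F)) (w : R3 → G) (hw : ContDiff ℝ (⊤ : ℕ∞) w)
    (h0 : ∀ x, x ∉ tsupport u → w x = 0) : 𝓓(Ω, G) where
  toFun := w
  contDiff' := hw
  hasCompactSupport' := u.hasCompactSupport.mono' fun x hx => by
    by_contra h
    exact hx (h0 x h)
  tsupport_subset' := (closure_minimal (fun x hx => by
    by_contra h
    exact hx (h0 x h)) (isClosed_tsupport u)).trans u.tsupport_subset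

theorem tsupport_coord (v : R3 → Vec 𝕜) (i : Fin 3) : tsupport (fun x => v x i) ⊆ tsupport v :=
  closure_mono fun x hx h => hx (by simp [h])

/-- The gradient of a test function. -/
def gradTest : 𝓓(Ω, 𝕜) →ₗ[𝕜] 𝓓(Ω, Vec 𝕜) where
  toFun u := mkTest u (gradFun u)
    (by
      refine (contDiff_piLp 2).2 fun i => ?_
      fin_cases i <;> exact contDiff_pd _ u.contDiff)
    (fun x hx => by
      ext i
      fin_cases i <;> simp [gradFun, pd_eq_zero _ hx])
  map_add' u v := by
    ext x i
    fin_cases i <;> exact pd_add _ u.contDiff v.contDiff x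
  map_smul' c u := by
    ext x i
    fin_cases i <;> exact pd_smul _ u.contDiff c x

/-- The divergence of a test field. -/
def divTest : 𝓓(Ω, Vec 𝕜) →ₗ[𝕜] 𝓓(Ω, 𝕜) where
  toFun v := mkTest v (divFun v)
    (((contDiff_pd _ (contDiff_coord v.contDiff _)).add
      (contDiff_pd _ (contDiff_coord v.contDiff _))).add
      (contDiff_pd _ (contDiff_coord v.contDiff _)))
    (fun x hx => by
      have h : ∀ i j, pd i (fun y => v y j) x = 0 := fun i j =>
        pd_eq_zero _ fun h => hx (tsupport_coord v j h)
      simp [divFun, h])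
  map_add' u v := by
    have h : ∀ i j x, pd i (fun y => (u + v : 𝓓(Ω, Vec 𝕜)) y j) x
        = pd i (fun y => u y j) x + pd i (fun y => v y j) x := fun i j x =>
      pd_add i (contDiff_coord u.contDiff j) (contDiff_coord v.contDiff j) x
    ext x
    have key : divFun (u + v : 𝓓(Ω, Vec 𝕜)) x = divFun u x + divFun v x := by
      simp only [divFun, h]
      ring
    exact key
  map_smul' c u := by
    have h : ∀ i j x, pd i (fun y => (c • u : 𝓓(Ω, Vec 𝕜)) y j) x
        = c * pd i (fun y => u y j) x := fun i j x =>
      pd_smul i (contDiff_coord u.contDiff j) c x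
    ext x
    have key : divFun (c • u : 𝓓(Ω, Vec 𝕜)) x = c * divFun u x := by
      simp only [divFun, h]
      ring
    exact key

/-- The rotation of a test field. -/
def curlTest : 𝓓(Ω, Vec 𝕜) →ₗ[𝕜] 𝓓(Ω, Vec 𝕜) where
  toFun v := mkTest v (curlFun v)
    (by
      refine (contDiff_piLp 2).2 fun i => ?_
      fin_cases i <;>
        exact (contDiff_pd _ (contDiff_coord v.contDiff _)).sub
          (contDiff_pd _ (contDiff_coord v.contDiff _)))
    (fun x hx => by
      have h : ∀ i j, pd i (fun y => v y j) x = 0 := fun i j =>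
        pd_eq_zero _ fun h => hx (tsupport_coord v j h)
      ext i
      fin_cases i <;> simp [curlFun, h])
  map_add' u v := by
    have h : ∀ i j x, pd i (fun y => (u + v : 𝓓(Ω, Vec 𝕜)) y j) x
        = pd i (fun y => u y j) x + pd i (fun y => v y j) x := fun i j x =>
      pd_add i (contDiff_coord u.contDiff j) (contDiff_coord v.contDiff j) x
    ext x i
    have key : curlFun (u + v : 𝓓(Ω, Vec 𝕜)) x i = curlFun u x i + curlFun v x i := by
      fin_cases i <;> (simp only [curlFun, h]; simp; ring)
    exact key
  map_smul' c u := by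
    have h : ∀ i j x, pd i (fun y => (c • u : 𝓓(Ω, Vec 𝕜)) y j) x
        = c * pd i (fun y => u y j) x := fun i j x =>
      pd_smul i (contDiff_coord u.contDiff j) c x
    ext x i
    have key : curlFun (c • u : 𝓓(Ω, Vec 𝕜)) x i = c * curlFun u x i := by
      fin_cases i <;> (simp only [curlFun, h]; simp; ring)
    exact key

/-- The class in `L₂(Ω)` of a test function. -/
def testToL2 {F : Type*} [NormedAddCommGroup F] [InnerProductSpace 𝕜 F] [NormedSpace ℝ F]
    [SMulCommClass ℝ 𝕜 F] : 𝓓(Ω, F) →ₗ[𝕜] Lp F 2 (volume.restrict (Ω : Set R3)) where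
  toFun u := (u.continuous.memLp_of_hasCompactSupport u.hasCompactSupport).toLp u
  map_add' _ _ := rfl
  map_smul' _ _ := rfl

theorem testToL2_ae {F : Type*} [NormedAddCommGroup F] [InnerProductSpace 𝕜 F] [NormedSpace ℝ F]
    [SMulCommClass ℝ 𝕜 F] (u : 𝓓(Ω, F)) :
    (testToL2 (𝕜 := 𝕜) u : R3 → F) =ᵐ[volume.restrict (Ω : Set R3)] u :=
  MemLp.coeFn_toLp (u.continuous.memLp_of_hasCompactSupport u.hasCompactSupport)

theorem testToL2_injective {F : Type*} [NormedAddCommGroup F] [InnerProductSpace 𝕜 F]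
    [NormedSpace ℝ F] [SMulCommClass ℝ 𝕜 F] :
    Function.Injective (testToL2 (𝕜 := 𝕜) (Ω := Ω) (F := F)) := by
  intro u v h
  have h1 : (u : R3 → F) =ᵐ[volume.restrict (Ω : Set R3)] v := by
    refine (testToL2_ae (𝕜 := 𝕜) u).symm.trans ?_
    rw [h]
    exact testToL2_ae (𝕜 := 𝕜) v
  have h2 := Measure.eqOn_open_of_ae_eq h1 Ω.isOpen u.continuous.continuousOn
    v.continuous.continuousOn
  ext x
  by_cases hx : x ∈ (Ω : Set R3)
  · exact h2 hx
  · rw [image_eq_zero_of_notMem_tsupport fun h => hx (u.tsupport_subset h),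
      image_eq_zero_of_notMem_tsupport fun h => hx (v.tsupport_subset h)]

/-- A linear operation on test functions, as an operator in `L₂` whose domain consists of the
(classes of) test functions. -/
def testOp {F G : Type*} [NormedAddCommGroup F] [InnerProductSpace 𝕜 F] [NormedSpace ℝ F]
    [SMulCommClass ℝ 𝕜 F] [NormedAddCommGroup G] [InnerProductSpace 𝕜 G] [NormedSpace ℝ G]
    [SMulCommClass ℝ 𝕜 G] (T : 𝓓(Ω, F) →ₗ[𝕜] 𝓓(Ω, G)) :
    Lp F 2 (volume.restrict (Ω : Set R3)) →ₗ.[𝕜] Lp G 2 (volume.restrict (Ω : Set R3)) where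
  domain := LinearMap.range (testToL2 (𝕜 := 𝕜) (Ω := Ω) (F := F))
  toFun := (testToL2 ∘ₗ T) ∘ₗ
    (LinearEquiv.ofInjective testToL2 (testToL2_injective (𝕜 := 𝕜) (Ω := Ω) (F := F))).symm

theorem testOp_apply {F G : Type*} [NormedAddCommGroup F] [InnerProductSpace 𝕜 F] [NormedSpace ℝ F]
    [SMulCommClass ℝ 𝕜 F] [NormedAddCommGroup G] [InnerProductSpace 𝕜 G] [NormedSpace ℝ G]
    [SMulCommClass ℝ 𝕜 G] (T : 𝓓(Ω, F) →ₗ[𝕜] 𝓓(Ω, G)) (u : 𝓓(Ω, F)) :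
    testOp (𝕜 := 𝕜) T ⟨testToL2 u, ⟨u, rfl⟩⟩ = testToL2 (𝕜 := 𝕜) (T u) := by
  have : (LinearEquiv.ofInjective testToL2 (testToL2_injective (𝕜 := 𝕜) (Ω := Ω) (F := F))).symm
      ⟨testToL2 u, ⟨u, rfl⟩⟩ = u := by
    rw [LinearEquiv.symm_apply_eq]
    rfl
  exact congrArg (fun w => testToL2 (𝕜 := 𝕜) (T w)) this

theorem dense_testOp {F G : Type*} [NormedAddCommGroup F] [InnerProductSpace 𝕜 F] [NormedSpace ℝ F]
    [SMulCommClass ℝ 𝕜 F] [IsScalarTower ℝ 𝕜 F] [CompleteSpace F]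
    [NormedAddCommGroup G] [InnerProductSpace 𝕜 G] [NormedSpace ℝ G]
    [SMulCommClass ℝ 𝕜 G] (T : 𝓓(Ω, F) →ₗ[𝕜] 𝓓(Ω, G)) :
    Dense ((testOp T).domain : Set (Lp F 2 (volume.restrict (Ω : Set R3)))) := by
  rw [Submodule.dense_iff_topologicalClosure_eq_top, Submodule.topologicalClosure_eq_top_iff,
    Submodule.eq_bot_iff]
  intro f hf
  have hmem : MemLp f 2 (volume.restrict (Ω : Set R3)) := Lp.memLp f
  have hloc : LocallyIntegrableOn f (Ω : Set R3) volume :=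
    locallyIntegrableOn_of_locallyIntegrable_restrict (hmem.locallyIntegrable (by norm_num))
  have key : ∀ g : R3 → ℝ, ContDiff ℝ (⊤ : ℕ∞) g → HasCompactSupport g → tsupport g ⊆ Ω →
      ∫ x, g x • f x = 0 := by
    intro g hg hgc hgs
    have hz : ∀ x, x ∉ (Ω : Set R3) → g x • f x = 0 := fun x hx => by
      rw [image_eq_zero_of_notMem_tsupport fun h => hx (hgs h), zero_smul]
    rw [← setIntegral_eq_integral_of_forall_compl_eq_zero hz]
    refine ext_inner_left 𝕜 fun c => ?_
    rw [inner_zero_right]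
    let u : 𝓓(Ω, F) := TestFunction.mk (fun x => g x • c) (hg.smul contDiff_const)
      hgc.smul_right ((tsupport_smul_subset_left g _).trans hgs)
    have hu := (Submodule.mem_orthogonal _ _).1 hf (testToL2 u) ⟨u, rfl⟩
    rw [L2.inner_def] at hu
    have hint : Integrable (fun x => g x • f x) (volume.restrict (Ω : Set R3)) := by
      rw [← memLp_one_iff_integrable]
      exact hmem.smul (hg.continuous.memLp_of_hasCompactSupport (p := 2) hgc)
    rw [← integral_inner hint, ← hu]
    refine integral_congr_ae ?_
    filter_upwards [testToL2_ae (𝕜 := 𝕜) u] with x hx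
    rw [hx]
    change _ = inner 𝕜 (g x • c) (f x)
    rw [← algebraMap_smul 𝕜 (g x) (f x : F), ← algebraMap_smul 𝕜 (g x) c, inner_smul_left,
      inner_smul_right]
    simp
  have h0 := IsOpen.ae_eq_zero_of_integral_contDiff_smul_eq_zero Ω.isOpen hloc key
  rw [Lp.eq_zero_iff_ae_eq_zero]
  exact (ae_restrict_iff' Ω.isOpen.measurableSet).2 h0

theorem inner_testToL2 {F : Type*} [NormedAddCommGroup F] [InnerProductSpace 𝕜 F] [NormedSpace ℝ F]
    [SMulCommClass ℝ 𝕜 F] (u v : 𝓓(Ω, F)) :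
    inner 𝕜 (testToL2 (𝕜 := 𝕜) u) (testToL2 (𝕜 := 𝕜) v) = ∫ x, inner 𝕜 (u x) (v x) := by
  rw [L2.inner_def, ← setIntegral_eq_integral_of_forall_compl_eq_zero (s := (Ω : Set R3))
    (f := fun x => inner 𝕜 (u x) (v x))]
  · refine integral_congr_ae ?_
    filter_upwards [testToL2_ae (𝕜 := 𝕜) u, testToL2_ae (𝕜 := 𝕜) v] with x hx hy
    rw [hx, hy]
  · intro x hx
    rw [image_eq_zero_of_notMem_tsupport fun h => hx (u.tsupport_subset h), inner_zero_left]

theorem ibp (i : Fin 3) {u v : R3 → 𝕜} (hu : ContDiff ℝ (⊤ : ℕ∞) u) (hv : ContDiff ℝ (⊤ : ℕ∞) v)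
    (hc : HasCompactSupport u) :
    Integrable (fun x => inner 𝕜 (u x) (v x)) ∧
    ∫ x, inner 𝕜 (u x) (pd i v x) = - ∫ x, inner 𝕜 (pd i u x) (v x) := by
  have hI : ∀ {a b : R3 → 𝕜}, ContDiff ℝ (⊤ : ℕ∞) a → ContDiff ℝ (⊤ : ℕ∞) b →
      (∀ x, x ∉ tsupport u → a x = 0) → Integrable (fun x => inner 𝕜 (a x) (b x)) := by
    intro a b ha hb h0
    refine (ha.continuous.inner hb.continuous).integrable_of_hasCompactSupport ?_
    refine hc.mono' fun x hx => ?_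
    by_contra h
    exact hx (by simp [h0 x h])
  have hz : ∀ x, x ∉ tsupport u → u x = 0 := fun x hx => image_eq_zero_of_notMem_tsupport hx
  have hz' : ∀ x, x ∉ tsupport u → pd i u x = 0 := fun x hx => pd_eq_zero i hx
  refine ⟨hI hu hv hz, ?_⟩
  let B : 𝕜 →L[ℝ] 𝕜 →L[ℝ] 𝕜 := (ContinuousLinearMap.mul ℝ 𝕜).comp (RCLike.conjCLE (K := 𝕜) : 𝕜 →L[ℝ] 𝕜)
  have hB : ∀ a b : 𝕜, B a b = inner 𝕜 a b := fun a b => by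
    simp [B, RCLike.inner_apply, mul_comm]
  have := integral_bilinear_fderiv_right_eq_neg_left_of_integrable (μ := (volume : Measure R3))
    (B := B) (f := u) (g := v) (v := e i)
    (by simp only [hB]; exact hI (contDiff_pd i hu) hv hz')
    (by simp only [hB]; exact hI hu (contDiff_pd i hv) hz)
    (by simpa only [hB] using hI hu hv hz)
    (fun x _ => hu.differentiable (by simp) x)
    (fun x _ => hv.differentiable (by simp) x)
  simp only [hB] at this
  exact this

theorem integral_add3 {a b c : R3 → 𝕜} (ha : Integrable a) (hb : Integrable b) (hc : Integrable c) :
    ∫ x, (a x + b x + c x) = (∫ x, a x) + (∫ x, b x) + ∫ x, c x := by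
  rw [integral_add (f := fun x => a x + b x) (ha.add hb) hc, integral_add ha hb]

theorem inner_gradTest (u : 𝓓(Ω, 𝕜)) (v : 𝓓(Ω, Vec 𝕜)) :
    inner 𝕜 (testToL2 (𝕜 := 𝕜) (gradTest u)) (testToL2 (𝕜 := 𝕜) v)
      = inner 𝕜 (testToL2 (𝕜 := 𝕜) u) (testToL2 (𝕜 := 𝕜) (-divTest v)) := by
  rw [inner_testToL2, inner_testToL2]
  have hu : ContDiff ℝ (⊤ : ℕ∞) u := u.contDiff
  have hv : ∀ j, ContDiff ℝ (⊤ : ℕ∞) (fun y => v y j) := contDiff_coord v.contDiff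
  have hc : HasCompactSupport u := u.hasCompactSupport
  have hc' : ∀ i, HasCompactSupport (pd i u) := fun i => hc.mono' fun x hx => by
    by_contra h
    exact hx (pd_eq_zero i h)
  have h1 : ∀ i, Integrable (fun x => inner 𝕜 (pd i u x) (v x i)) := fun i =>
    (ibp i (contDiff_pd i hu) (hv i) (hc' i)).1
  have h2 : ∀ i, Integrable (fun x => inner 𝕜 (u x) (pd i (fun y => v y i) x)) := fun i =>
    (ibp i hu (contDiff_pd i (hv i)) hc).1
  have e1 : ∀ x, inner 𝕜 (gradTest u x) (v x) = inner 𝕜 (pd 0 u x) (v x 0)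
      + inner 𝕜 (pd 1 u x) (v x 1) + inner 𝕜 (pd 2 u x) (v x 2) := fun x => by
    rw [PiLp.inner_apply, Fin.sum_univ_three]
    rfl
  have e2 : ∀ x, inner 𝕜 (u x) ((-divTest v : 𝓓(Ω, 𝕜)) x)
      = -(inner 𝕜 (u x) (pd 0 (fun y => v y 0) x) + inner 𝕜 (u x) (pd 1 (fun y => v y 1) x)
        + inner 𝕜 (u x) (pd 2 (fun y => v y 2) x)) := fun x => by
    change inner 𝕜 (u x) (-(divFun v x)) = _
    rw [divFun, inner_neg_right, inner_add_right, inner_add_right]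
  simp only [e1, e2]
  rw [integral_neg, integral_add3 (h1 0) (h1 1) (h1 2), integral_add3 (h2 0) (h2 1) (h2 2),
    (ibp 0 hu (hv 0) hc).2, (ibp 1 hu (hv 1) hc).2, (ibp 2 hu (hv 2) hc).2]
  ring

theorem inner_curlTest (u v : 𝓓(Ω, Vec 𝕜)) :
    inner 𝕜 (testToL2 (𝕜 := 𝕜) (curlTest u)) (testToL2 (𝕜 := 𝕜) v)
      = inner 𝕜 (testToL2 (𝕜 := 𝕜) u) (testToL2 (𝕜 := 𝕜) (curlTest v)) := by
  rw [inner_testToL2, inner_testToL2]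
  have hu : ∀ j, ContDiff ℝ (⊤ : ℕ∞) (fun y => u y j) := contDiff_coord u.contDiff
  have hv : ∀ j, ContDiff ℝ (⊤ : ℕ∞) (fun y => v y j) := contDiff_coord v.contDiff
  have hc : ∀ j, HasCompactSupport (fun y => u y j) := fun j =>
    u.hasCompactSupport.mono' fun x hx => tsupport_coord u j (subset_tsupport _ hx)
  have hc' : ∀ i j, HasCompactSupport (pd i (fun y => u y j)) := fun i j =>
    (hc j).mono' fun x hx => by
      by_contra h
      exact hx (pd_eq_zero i h)
  have h1 : ∀ i j k, Integrable (fun x => inner 𝕜 (pd i (fun y => u y j) x) (v x k)) :=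
    fun i j k => (ibp i (contDiff_pd i (hu j)) (hv k) (hc' i j)).1
  have h2 : ∀ i j k, Integrable (fun x => inner 𝕜 (u x j) (pd i (fun y => v y k) x)) :=
    fun i j k => (ibp i (hu j) (contDiff_pd i (hv k)) (hc j)).1
  have e1 : ∀ x, inner 𝕜 (curlTest u x) (v x) =
      (inner 𝕜 (pd 1 (fun y => u y 2) x) (v x 0) - inner 𝕜 (pd 2 (fun y => u y 1) x) (v x 0))
      + (inner 𝕜 (pd 2 (fun y => u y 0) x) (v x 1) - inner 𝕜 (pd 0 (fun y => u y 2) x) (v x 1))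
      + (inner 𝕜 (pd 0 (fun y => u y 1) x) (v x 2) - inner 𝕜 (pd 1 (fun y => u y 0) x) (v x 2)) :=
    fun x => by
    rw [PiLp.inner_apply, Fin.sum_univ_three]
    simp only [← inner_sub_left]
    rfl
  have e2 : ∀ x, inner 𝕜 (u x) (curlTest v x) =
      (inner 𝕜 (u x 0) (pd 1 (fun y => v y 2) x) - inner 𝕜 (u x 0) (pd 2 (fun y => v y 1) x))
      + (inner 𝕜 (u x 1) (pd 2 (fun y => v y 0) x) - inner 𝕜 (u x 1) (pd 0 (fun y => v y 2) x))
      + (inner 𝕜 (u x 2) (pd 0 (fun y => v y 1) x) - inner 𝕜 (u x 2) (pd 1 (fun y => v y 0) x)) :=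
    fun x => by
    rw [PiLp.inner_apply, Fin.sum_univ_three]
    simp only [← inner_sub_right]
    rfl
  have i1 : ∀ i j i' j' k, Integrable (fun x => inner 𝕜 (pd i (fun y => u y j) x) (v x k)
      - inner 𝕜 (pd i' (fun y => u y j') x) (v x k)) := fun i j i' j' k =>
    (h1 i j k).sub (h1 i' j' k)
  have i2 : ∀ i k i' k' j, Integrable (fun x => inner 𝕜 (u x j) (pd i (fun y => v y k) x)
      - inner 𝕜 (u x j) (pd i' (fun y => v y k') x)) := fun i k i' k' j =>
    (h2 i j k).sub (h2 i' j k')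
  simp only [e1, e2]
  rw [integral_add3 (i1 _ _ _ _ _) (i1 _ _ _ _ _) (i1 _ _ _ _ _),
    integral_sub (h1 _ _ _) (h1 _ _ _), integral_sub (h1 _ _ _) (h1 _ _ _),
    integral_sub (h1 _ _ _) (h1 _ _ _),
    integral_add3 (i2 _ _ _ _ _) (i2 _ _ _ _ _) (i2 _ _ _ _ _),
    integral_sub (h2 _ _ _) (h2 _ _ _), integral_sub (h2 _ _ _) (h2 _ _ _),
    integral_sub (h2 _ _ _) (h2 _ _ _)]
  have b : ∀ i j k, ∫ x, inner 𝕜 (u x j) (pd i (fun y => v y k) x)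
      = - ∫ x, inner 𝕜 (pd i (fun y => u y j) x) (v x k) := fun i j k =>
    (ibp i (hu j) (hv k) (hc j)).2
  simp only [b]
  ring

end Test

/-- The gradient with domain `C_c^∞(Ω)`. -/
def gradC : L2S 𝕜 Ω →ₗ.[𝕜] L2V 𝕜 Ω := testOp gradTest

/-- The rotation with domain `C_c^∞(Ω)³`. -/
def curlC : L2V 𝕜 Ω →ₗ.[𝕜] L2V 𝕜 Ω := testOp curlTest

theorem gradC_isClosable : (gradC 𝕜 Ω).IsClosable := by
  have hd : Dense ((testOp (𝕜 := 𝕜) (Ω := Ω) (-divTest)).domain : Set (L2V 𝕜 Ω)) := dense_testOp _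
  refine (LinearPMap.adjoint_isClosed hd).isClosable.leIsClosable ?_
  refine LinearPMap.IsFormalAdjoint.le_adjoint hd (LinearPMap.IsFormalAdjoint.symm ?_)
  rintro ⟨_, u, rfl⟩ ⟨_, v, rfl⟩
  have h := inner_gradTest u v
  rw [← testOp_apply gradTest u] at h
  refine h.trans ?_
  congr 1
  exact (testOp_apply (-divTest) v).symm

/-- The gradient `grad°` with domain `H¹₀(Ω)`, the closure of `C_c^∞(Ω)` in the graph norm. -/
def grad0 : L2S 𝕜 Ω →ₗ.[𝕜] L2V 𝕜 Ω := (gradC 𝕜 Ω).closure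

theorem dense_grad0 : Dense ((grad0 𝕜 Ω).domain : Set (L2S 𝕜 Ω)) :=
  (dense_testOp (𝕜 := 𝕜) (Ω := Ω) gradTest).mono (LinearPMap.le_closure (gradC 𝕜 Ω)).1

/-- The divergence `div = -(grad°)^*` in `L₂` with its maximal domain. -/
def dive : L2V 𝕜 Ω →ₗ.[𝕜] L2S 𝕜 Ω := -(grad0 𝕜 Ω)†

/-- The distributional rotation with its maximal domain: `E ∈ dom curl` with `curl E = F` iff
`⟪F, ψ⟫ = ⟪E, curl ψ⟫` for all test fields `ψ`. -/
def curl : L2V 𝕜 Ω →ₗ.[𝕜] L2V 𝕜 Ω := (curlC 𝕜 Ω)†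

theorem curlC_le_curl : curlC 𝕜 Ω ≤ curl 𝕜 Ω := by
  refine LinearPMap.IsFormalAdjoint.le_adjoint (dense_testOp _) ?_
  rintro ⟨_, u, rfl⟩ ⟨_, v, rfl⟩
  have h := inner_curlTest u v
  rw [← testOp_apply curlTest u, ← testOp_apply curlTest v] at h
  exact h

theorem dense_curl : Dense ((curl 𝕜 Ω).domain : Set (L2V 𝕜 Ω)) :=
  (dense_testOp (𝕜 := 𝕜) (Ω := Ω) curlTest).mono (curlC_le_curl 𝕜 Ω).1

/-- `curl° = curl^*`, the rotation with vanishing tangential trace. -/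
def curl0 : L2V 𝕜 Ω →ₗ.[𝕜] L2V 𝕜 Ω := (curl 𝕜 Ω)†

/-- `curl_red`, with domain `dom curl ∩ (ker curl)ᗮ`. -/
def curlRed : L2V 𝕜 Ω →ₗ.[𝕜] L2V 𝕜 Ω := reduced (curl 𝕜 Ω)

/-- `H⁻¹(Ω)`, the dual of `H¹₀(Ω)`. -/
abbrev HnegGrad : Type _ := Hneg1 (grad0 𝕜 Ω)

/-- `H⁻¹(curl_red)`, the dual of `H¹(curl_red)`. -/
abbrev HnegCurl : Type _ := Hneg1 (curlRed 𝕜 Ω)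

/-- The distributional divergence `L₂(Ω)³ → H⁻¹(Ω)`, `(div Φ)(u) = -⟪Φ, grad° u⟫`. -/
def divD (Φ : L2V 𝕜 Ω) : HnegGrad 𝕜 Ω := -diamond (grad0 𝕜 Ω) Φ

/-- The distributional rotation with boundary condition `L₂(Ω)³ → H⁻¹(curl_red)`,
`(curl° E)(v) = ⟪E, curl v⟫`. -/
def curlD (E : L2V 𝕜 Ω) : HnegCurl 𝕜 Ω := diamond (curlRed 𝕜 Ω) E

/-- The electric compactness property: `dom div ∩ dom curl°`, with its graph norm, embeds compactly
into `L₂(Ω)³`, i.e. the image of its closed unit ball is relatively compact. -/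
def ElectricCompactness : Prop :=
  IsCompact (closure {E : L2V 𝕜 Ω | ∃ (hd : E ∈ (dive 𝕜 Ω).domain) (hc : E ∈ (curl0 𝕜 Ω).domain),
    ‖E‖ ^ 2 + ‖dive 𝕜 Ω ⟨E, hd⟩‖ ^ 2 + ‖curl0 𝕜 Ω ⟨E, hc⟩‖ ^ 2 ≤ 1})

/-- The closure of `ran grad°`; it is `ran grad°` itself as soon as that range is closed, in
particular under the electric compactness property. -/
def clRanGrad : Submodule 𝕜 (L2V 𝕜 Ω) := (ran (grad0 𝕜 Ω)).topologicalClosure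

/-- The closure of `ran curl`; it is `ran curl` itself as soon as that range is closed, in
particular under the electric compactness property. -/
def clRanCurl : Submodule 𝕜 (L2V 𝕜 Ω) := (ran (curl 𝕜 Ω)).topologicalClosure

instance : CompleteSpace (clRanGrad 𝕜 Ω) := Submodule.topologicalClosure.completeSpace _

instance : CompleteSpace (clRanCurl 𝕜 Ω) := Submodule.topologicalClosure.completeSpace _

/-! ### Electrostatics -/

variable {𝕜 Ω}

/-- Admissible coefficients: `ε`, its compression to `ran grad°`, and the compression of `ε⁻¹` to
`ran curl` are (boundedly) invertible. -/
structure Admissible (ε : L2V 𝕜 Ω →L[𝕜] L2V 𝕜 Ω) : Prop where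
  a1 : IsUnit ε
  a2 : IsUnit (block (clRanGrad 𝕜 Ω) (clRanGrad 𝕜 Ω) ε)
  a3 : IsUnit (block (clRanCurl 𝕜 Ω) (clRanCurl 𝕜 Ω) (Ring.inverse ε))

theorem Admissible.mem_MSet {ε : L2V 𝕜 Ω →L[𝕜] L2V 𝕜 Ω} (h : Admissible ε) :
    ε ∈ MSet (clRanGrad 𝕜 Ω) := ⟨h.a2, h.a1⟩

/-- `ε_n → ε` in `τ_bH = τ_b(ran grad°, (ran grad°)ᗮ)`, for admissible operators. -/
def ConvBH (ε : ℕ → L2V 𝕜 Ω →L[𝕜] L2V 𝕜 Ω) (ε' : L2V 𝕜 Ω →L[𝕜] L2V 𝕜 Ω)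
    (h : ∀ n, Admissible (ε n)) (h' : Admissible ε') : Prop :=
  Tendsto (fun n => (⟨ε n, (h n).mem_MSet⟩ : MSet (clRanGrad 𝕜 Ω))) atTop
    (@nhds _ (tauB (clRanGrad 𝕜 Ω)) ⟨ε', h'.mem_MSet⟩)

/-- `H_ε = ker (div ε) ∩ ker curl°`. -/
def Heps (ε : L2V 𝕜 Ω →L[𝕜] L2V 𝕜 Ω) : Submodule 𝕜 (L2V 𝕜 Ω) :=
  (ker (dive 𝕜 Ω)).comap ε.toLinearMap ⊓ ker (curl0 𝕜 Ω)

open Classical in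
/-- The projection `π_ε` onto `H_ε` belonging to the direct decomposition
`L₂(Ω)³ = ran grad° ∔ ε⁻¹ ran curl ∔ H_ε`, which is available for admissible `ε` if the ranges of
`grad°` and `curl` are closed (otherwise the value `0` is used). -/
def piEps (ε : L2V 𝕜 Ω →L[𝕜] L2V 𝕜 Ω) : L2V 𝕜 Ω →ₗ[𝕜] L2V 𝕜 Ω :=
  if h : IsCompl (Heps ε)
      (ran (grad0 𝕜 Ω) ⊔ (ran (curl 𝕜 Ω)).map (Ring.inverse ε).toLinearMap) then
    Submodule.projection _ _ h
  else 0

variable (𝕜 Ω)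

/-- The harmonic Dirichlet fields `H_D(Ω) = ker div ∩ ker curl°`. -/
def HD : Submodule 𝕜 (L2V 𝕜 Ω) := ker (dive 𝕜 Ω) ⊓ ker (curl0 𝕜 Ω)

theorem HD_eq : HD 𝕜 Ω = (ran (grad0 𝕜 Ω))ᗮ ⊓ (ran (curl 𝕜 Ω))ᗮ := by
  have h : ker (dive 𝕜 Ω) = ker (grad0 𝕜 Ω)† := by
    ext x
    simp only [mem_ker, dive, LinearPMap.neg_apply, neg_eq_zero]
    rfl
  rw [HD, h, curl0, ker_adjoint (dense_grad0 𝕜 Ω), ker_adjoint (dense_curl 𝕜 Ω)]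

instance : CompleteSpace (HD 𝕜 Ω) := by
  rw [HD_eq]
  exact ((Submodule.isClosed_orthogonal _).inter (Submodule.isClosed_orthogonal _)).completeSpace_coe

/-- The orthogonal projection `π_D` onto the harmonic Dirichlet fields. -/
def piD : L2V 𝕜 Ω →L[𝕜] HD 𝕜 Ω := (HD 𝕜 Ω).orthogonalProjectionOnto

variable {𝕜 Ω}

/-- `E` solves `div ε E = f`, `curl° E = g`, `π_D π_ε E = x`. -/
structure Solves (ε : L2V 𝕜 Ω →L[𝕜] L2V 𝕜 Ω) (f : HnegGrad 𝕜 Ω) (g : HnegCurl 𝕜 Ω) (x : HD 𝕜 Ω)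
    (E : L2V 𝕜 Ω) : Prop where
  div_eq : divD 𝕜 Ω (ε E) = f
  curl_eq : curlD 𝕜 Ω E = g
  pi_eq : piD 𝕜 Ω (piEps ε E) = x

/-- Weak convergence in a Hilbert space. -/
def WeaklyTendsto {X : Type*} [NormedAddCommGroup X] [InnerProductSpace 𝕜 X] (u : ℕ → X) (v : X) :
    Prop := ∀ φ : X, Tendsto (fun n => inner 𝕜 φ (u n)) atTop (𝓝 (inner 𝕜 φ v))

end Electro

end

/-!
Write `G = ran grad°`, `C = ran curl` and `N = H_D(Ω)`.  Since `curl grad = 0`, the space `L₂(Ω)³`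
is the orthogonal sum of the closures of `G` and `C` and of `N`.  Electric compactness gives
Poincaré estimates for `div` on `G` and for `curl°` on `C`, so that both ranges are closed and
`div`, `curl^⋄` are bounded below on them (`exists_estimate_of_isCompact`,
`exists_preimage_of_adjoint_estimate`,
`norm_starProjection_le_diamond`).  It also makes `N` finite-dimensional.  The system therefore
prescribes the component `d` of `ε E` in `G`, the component `k` of `E` in `C`, and
`π_D π_ε E = x`.

Let `E₀`, `E₁` be the components of `E` in `G` and `Gᗮ`.  With the Schur components
`s₀₀, s₀₁, s₁₀, s₁₁` of `ε`,

  `E₀ = s₀₀ d - s₀₁ E₁`,   `(ε E)₁ = s₁₀ d + s₁₁ E₁`,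

and the condition `π_D π_ε E = x` says exactly that `s₁₁ (E₁ - x)` has no component in `N`
(`AdmissibleFor.proj_projection_eq_iff`).  As `E₁ = k + y + x` with `y ∈ N`, this is a linear
system for `y` in the finite-dimensional space `N`, whose matrix, the compression of `s₁₁` to `N`,
is injective (`AdmissibleFor.eq_zero_of_proj_s11`).

A sequence converging in `tauB` stays in one ball and its Schur components converge in the weak
operator topology (`exists_eventually_mem_MBall`, `tendsto_schurMap`).  On `N` weak convergence is
norm convergence, so the matrices and right-hand sides of the systems for `y` converge, and `E₁`
converges in norm.  Then `E₀` and `(ε E)₁` converge weakly, being images of norm convergent data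
under bounded weakly convergent operators.  In `⟪ε E, E⟫ = ⟪d, E₀⟫ + ⟪(ε E)₁, E₁⟫` each weakly
convergent factor meets a norm convergent one, so the energies converge as well
(`exists_solvesFor_of_tendsto`).
-/

namespace Electro

/-! ### Closed ranges of unbounded operators -/

section ClosedRange

variable {𝕜 X Y : Type*} [RCLike 𝕜]
  [NormedAddCommGroup X] [InnerProductSpace 𝕜 X]
  [NormedAddCommGroup Y] [InnerProductSpace 𝕜 Y]

theorem isClosed_H1 {T : X →ₗ.[𝕜] Y} (hc : T.IsClosed) :
    IsClosed (H1 T : Set (WithLp 2 (X × Y))) :=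
  IsClosed.preimage (WithLp.prod_continuous_ofLp 2 X Y) hc

/-- A closed densely defined operator is its own second adjoint: a pair `(x, y)` that satisfies the
adjoint relation with every element of the graph of `T†` lies in the graph of `T`, because the
closed graph of `T` is its own double orthogonal complement. -/
theorem exists_apply_eq_of_adjoint [CompleteSpace X] [CompleteSpace Y] {T : X →ₗ.[𝕜] Y}
    (hT : Dense (T.domain : Set X)) (hc : T.IsClosed) {x : X} {y : Y}
    (h : ∀ z : T†.domain, inner 𝕜 x (T† z) = inner 𝕜 y (z : Y)) :
    ∃ hx : x ∈ T.domain, T ⟨x, hx⟩ = y := by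
  suffices hm : WithLp.toLp 2 (x, y) ∈ H1 T from mem_H1.1 hm
  have hcl : (H1 T).topologicalClosure = H1 T := (isClosed_H1 hc).submodule_topologicalClosure_eq
  rw [← hcl, ← Submodule.orthogonal_orthogonal_eq_closure, Submodule.mem_orthogonal']
  intro p hp
  rw [Submodule.mem_orthogonal'] at hp
  -- an element `(u, v)` orthogonal to the graph satisfies `T† v = -u`
  have hw : ∀ w : T.domain, inner 𝕜 (-p.fst) (w : X) = inner 𝕜 p.snd (T w) := fun w => by
    have := hp (WithLp.toLp 2 ((w : X), T w)) (mem_H1.2 ⟨w.2, rfl⟩)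
    rw [WithLp.prod_inner_apply] at this
    rw [inner_neg_left]
    exact neg_eq_of_add_eq_zero_right this
  have hd := LinearPMap.mem_adjoint_domain_of_exists (T := T) p.snd ⟨_, hw⟩
  have he := LinearPMap.adjoint_apply_eq hT ⟨p.snd, hd⟩ hw
  have := h ⟨p.snd, hd⟩
  rw [he, inner_neg_right] at this
  rw [WithLp.prod_inner_apply]
  change inner 𝕜 x p.fst + inner 𝕜 y p.snd = 0
  rw [← this, add_neg_cancel]

/-- A Poincaré-type estimate for `T†` on the closure of `ran T` shows that `ran T` is closed, and
that preimages can be chosen with the same constant. -/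
theorem exists_preimage_of_adjoint_estimate [CompleteSpace X] [CompleteSpace Y] {T : X →ₗ.[𝕜] Y}
    (hT : Dense (T.domain : Set X)) (hc : T.IsClosed) {c : ℝ} (hc0 : 0 ≤ c)
    (hest : ∀ z : T†.domain, (z : Y) ∈ (ran T).topologicalClosure → ‖(z : Y)‖ ≤ c * ‖T† z‖)
    {y : Y} (hy : y ∈ (ran T).topologicalClosure) :
    ∃ x : T.domain, T x = y ∧ ‖(x : X)‖ ≤ c * ‖y‖ := by
  set R := (ran T).topologicalClosure with hR
  have : CompleteSpace R := Submodule.topologicalClosure.completeSpace _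
  let D : Submodule 𝕜 T†.domain := R.comap T†.domain.subtype
  let B : D →ₗ[𝕜] X := T†.toFun.domRestrict D
  have hB : ∀ d : D, ‖((d : T†.domain) : Y)‖ ≤ c * ‖B d‖ := fun d => hest d.1 d.2
  have hinj : Function.Injective B := by
    rw [← LinearMap.ker_eq_bot, LinearMap.ker_eq_bot']
    intro d hd
    have := hB d
    rw [hd, norm_zero, mul_zero] at this
    exact Subtype.ext (Subtype.ext (norm_le_zero_iff.1 this))
  let eB := LinearEquiv.ofInjective B hinj
  -- the functional `T† z ↦ ⟪y, z⟫` on `T† (dom T† ∩ R)`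
  let l0 : LinearMap.range B →ₗ[𝕜] 𝕜 :=
    (innerₛₗ 𝕜 y) ∘ₗ T†.domain.subtype ∘ₗ D.subtype ∘ₗ eB.symm.toLinearMap
  have hl0 : ∀ d : D, l0 (eB d) = inner 𝕜 y ((d : T†.domain) : Y) := fun d => by
    simp [l0]
  have hbd : ∀ w, ‖l0 w‖ ≤ (c * ‖y‖) * ‖w‖ := by
    intro w
    obtain ⟨d, rfl⟩ := eB.surjective w
    rw [hl0]
    refine (norm_inner_le_norm _ _).trans ?_
    have h1 : ‖eB d‖ = ‖B d‖ := rfl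
    rw [h1]
    nlinarith [hB d, norm_nonneg y]
  obtain ⟨l, hl, hnorm⟩ := exists_extension_norm_eq (𝕜 := 𝕜) _ (l0.mkContinuous _ hbd)
  let x := (InnerProductSpace.toDual 𝕜 X).symm l
  have hx : ∀ w, inner 𝕜 x w = l w := fun w => InnerProductSpace.toDual_symm_apply
  have hker : ker T† = Rᗮ := by rw [ker_adjoint hT, hR, Submodule.orthogonal_closure]
  have key : ∀ z : T†.domain, inner 𝕜 x (T† z) = inner 𝕜 y (z : Y) := by
    intro z
    -- only the component of `z` in `R` matters on both sides
    have hk : (z : Y) - R.starProjection z ∈ ker T† := by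
      rw [hker]; exact Submodule.sub_starProjection_mem_orthogonal _
    obtain ⟨hk1, hk2⟩ := mem_ker.1 hk
    have hPz : R.starProjection (z : Y) ∈ T†.domain := by
      have := T†.domain.sub_mem z.2 hk1
      rwa [sub_sub_cancel] at this
    have hTz : T† z = T† ⟨_, hPz⟩ := by
      have : z = ⟨_, hk1⟩ + ⟨_, hPz⟩ := Subtype.ext (by simp)
      conv_lhs => rw [this]
      rw [LinearPMap.map_add, hk2, zero_add]
    let d : D := ⟨⟨_, hPz⟩, R.starProjection_apply_mem _⟩
    have h1 : T† z = (eB d : X) := hTz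
    rw [h1, hx, hl (eB d)]
    change l0 (eB d) = _
    rw [hl0]
    change inner 𝕜 y (R.starProjection (z : Y)) = _
    rw [← Submodule.inner_starProjection_left_eq_right,
      Submodule.starProjection_eq_self_iff.2 hy]
  obtain ⟨hxd, hxy⟩ := exists_apply_eq_of_adjoint hT hc key
  refine ⟨⟨x, hxd⟩, hxy, ?_⟩
  change ‖x‖ ≤ _
  rw [LinearIsometryEquiv.norm_map, hnorm]
  exact LinearMap.mkContinuous_norm_le _ (by positivity) _

/-- Compactness of the unit ball of the graph norm gives a Poincaré-type estimate off the kernel. -/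
theorem exists_estimate_of_isCompact {B : Y →ₗ.[𝕜] X} (hB : B.IsClosed) {V : Submodule 𝕜 Y}
    (hV : IsClosed (V : Set Y)) (h0 : ∀ y ∈ V, y ∈ ker B → y = 0) {K : Set Y} (hK : IsCompact K)
    (hsub : ∀ z : B.domain, (z : Y) ∈ V → ‖(z : Y)‖ ^ 2 + ‖B z‖ ^ 2 ≤ 1 → (z : Y) ∈ K) :
    ∃ c : ℝ, 0 ≤ c ∧ ∀ z : B.domain, (z : Y) ∈ V → ‖(z : Y)‖ ≤ c * ‖B z‖ := by
  by_contra! hcon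
  choose z hzV hz using fun n : ℕ => hcon (n + 1) (by positivity)
  have hzpos : ∀ n, 0 < ‖(z n : Y)‖ := fun n => lt_of_le_of_lt (by positivity) (hz n)
  -- normalise to norm `1 / 2`; then the graph norms are eventually at most `1`
  let r : ℕ → 𝕜 := fun n => ((2 * ‖(z n : Y)‖ : ℝ) : 𝕜)⁻¹
  have hr : ∀ n, ‖r n‖ = (2 * ‖(z n : Y)‖)⁻¹ := fun n => by
    rw [norm_inv, RCLike.norm_ofReal, abs_of_nonneg (by positivity)]
  have hw : ∀ n, ‖((r n • z n : B.domain) : Y)‖ = 1 / 2 := fun n => by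
    have := (hzpos n).ne'
    rw [Submodule.coe_smul, norm_smul, hr]
    field_simp
  have hBw : ∀ n, ‖B (r n • z n)‖ ≤ 1 / 2 * (1 / ((n : ℝ) + 1)) := fun n => by
    have h1 := hzpos n
    rw [LinearPMap.map_smul, norm_smul, hr, mul_inv, mul_assoc, ← one_div (2 : ℝ)]
    refine mul_le_mul_of_nonneg_left ?_ (by norm_num)
    rw [inv_mul_le_iff₀ h1, mul_one_div, le_div_iff₀ (by positivity), mul_comm]
    exact (hz n).le
  have hBw1 : ∀ n, ‖B (r n • z n)‖ ≤ 1 / 2 := fun n => by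
    refine (hBw n).trans ?_
    have : 1 / ((n : ℝ) + 1) ≤ 1 := by
      rw [div_le_one (by positivity)]; linarith [(Nat.cast_nonneg n : (0 : ℝ) ≤ n)]
    linarith
  have hmem : ∀ n, ((r n • z n : B.domain) : Y) ∈ K := fun n =>
    hsub _ (V.smul_mem _ (hzV n)) (by
      rw [hw]; nlinarith [hBw1 n, norm_nonneg (B (r n • z n))])
  obtain ⟨w, -, φ, hφ, hlim⟩ := hK.tendsto_subseq hmem
  have hB0 : Tendsto (fun n => B (r n • z n)) atTop (𝓝 0) := by
    refine squeeze_zero_norm hBw ?_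
    have := (tendsto_one_div_add_atTop_nhds_zero_nat (𝕜 := ℝ)).const_mul (1 / 2 : ℝ)
    rwa [mul_zero] at this
  have hg : (w, (0 : X)) ∈ B.graph :=
    IsClosed.mem_of_tendsto (f := fun n => ((((r (φ n) • z (φ n) : B.domain) : Y)),
      B (r (φ n) • z (φ n)))) hB (hlim.prodMk_nhds (hB0.comp hφ.tendsto_atTop))
      (Eventually.of_forall fun n => B.mem_graph _)
  rw [LinearPMap.mem_graph_iff] at hg
  obtain ⟨w', hw1, hw2⟩ := hg
  have hwV : w ∈ V := hV.mem_of_tendsto hlim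
    (Eventually.of_forall fun n => V.smul_mem _ (hzV _))
  have hw0 : w = 0 := h0 w hwV (mem_ker.2 ⟨(congrArg (· ∈ B.domain) hw1).mp w'.2, by
    refine Eq.trans ?_ hw2; congr 1; exact Subtype.ext hw1.symm⟩)
  have hn := tendsto_nhds_unique hlim.norm
    (tendsto_const_nhds.congr fun n => (hw (φ n)).symm)
  rw [hw0, norm_zero] at hn
  norm_num at hn

theorem diamond_sub (C : X →ₗ.[𝕜] Y) (Φ Ψ : Y) :
    diamond C (Φ - Ψ) = diamond C Φ - diamond C Ψ := by
  ext u
  simp [diamond_apply, inner_sub_left]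

theorem continuous_diamond (C : X →ₗ.[𝕜] Y) : Continuous (diamond C) :=
  ((innerSL 𝕜).continuous).clm_comp_const _

/-- `C^⋄` only sees the component in a subspace containing `ran C`. -/
theorem diamond_starProjection {C : X →ₗ.[𝕜] Y} {R : Submodule 𝕜 Y} [R.HasOrthogonalProjection]
    (hR : ran C ≤ R) (Φ : Y) : diamond C (R.starProjection Φ) = diamond C Φ := by
  ext u
  obtain ⟨h, hu⟩ := mem_H1.1 u.2
  rw [diamond_apply, diamond_apply, ← hu, Submodule.inner_starProjection_left_eq_right,
    Submodule.starProjection_eq_self_iff.2 (hR (mem_ran.2 ⟨_, rfl⟩))]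

/-- If every element of `R` has a preimage under `C` of controlled norm, then `C^⋄` is bounded
below on `R`: test `C^⋄ Φ` with a preimage of the projection of `Φ`. -/
theorem norm_starProjection_le_diamond {C : X →ₗ.[𝕜] Y} {R : Submodule 𝕜 Y}
    [R.HasOrthogonalProjection] {c : ℝ} (hc : 0 ≤ c)
    (hpre : ∀ y ∈ R, ∃ x : C.domain, C x = y ∧ ‖(x : X)‖ ≤ c * ‖y‖) (Φ : Y) :
    ‖R.starProjection Φ‖ ≤ (1 + c) * ‖diamond C Φ‖ := by
  obtain ⟨x, hx, hxn⟩ := hpre _ (R.starProjection_apply_mem Φ)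
  set d := R.starProjection Φ with hd
  rcases eq_or_ne d 0 with h | h
  · rw [h, norm_zero]; positivity
  · let u : H1 C := ⟨WithLp.toLp 2 ((x : X), C x), mem_H1.2 ⟨x.2, rfl⟩⟩
    have hval : diamond C Φ u = ((‖d‖ : 𝕜)) ^ 2 := by
      rw [diamond_apply]
      change inner 𝕜 Φ (C x) = _
      rw [hx, ← inner_self_eq_norm_sq_to_K, hd, Submodule.inner_starProjection_left_eq_right,
        Submodule.starProjection_eq_self_iff.2 (R.starProjection_apply_mem Φ)]
    have hu : ‖u‖ ≤ ‖(x : X)‖ + ‖d‖ := by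
      have : ‖u‖ ^ 2 = ‖(x : X)‖ ^ 2 + ‖C x‖ ^ 2 :=
        WithLp.prod_norm_sq_eq_of_L2 _
      rw [hx] at this
      refine abs_le_of_sq_le_sq' ?_ (by positivity) |>.2
      nlinarith [norm_nonneg (x : X), norm_nonneg d]
    have hle := (diamond C Φ).le_opNorm u
    rw [hval, norm_pow, RCLike.norm_ofReal, abs_norm] at hle
    have hd0 : 0 < ‖d‖ := norm_pos_iff.2 h
    have : ‖d‖ * ‖d‖ ≤ ((1 + c) * ‖diamond C Φ‖) * ‖d‖ := by
      nlinarith [norm_nonneg (diamond C Φ), mul_le_mul_of_nonneg_left (hu.trans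
        (add_le_add_left hxn _)) (norm_nonneg (diamond C Φ))]
    exact le_of_mul_le_mul_right this hd0

theorem ran_reduced_le (C : X →ₗ.[𝕜] Y) : ran (reduced C) ≤ ran C := by
  rintro _ ⟨x, rfl⟩
  exact ⟨⟨x.1, x.2.2⟩, rfl⟩

/-- Preimages can be moved into `(ker C)ᗮ` without enlarging their norms. -/
theorem exists_preimage_reduced [CompleteSpace X] {C : X →ₗ.[𝕜] Y}
    (hk : IsClosed (ker C : Set X)) {c : ℝ} {y : Y}
    (hpre : ∃ x : C.domain, C x = y ∧ ‖(x : X)‖ ≤ c * ‖y‖) :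
    ∃ x : (reduced C).domain, reduced C x = y ∧ ‖(x : X)‖ ≤ c * ‖y‖ := by
  obtain ⟨x, hx, hn⟩ := hpre
  have : CompleteSpace (ker C) := hk.completeSpace_coe
  obtain ⟨h1, h2⟩ := mem_ker.1 ((ker C).starProjection_apply_mem (x : X))
  have hs : (ker C)ᗮ.starProjection (x : X) = x - (ker C).starProjection (x : X) := by
    rw [Submodule.starProjection_orthogonal']; simp
  have hd : (ker C)ᗮ.starProjection (x : X) ∈ C.domain := by
    rw [hs]; exact C.domain.sub_mem x.2 h1
  refine ⟨⟨(ker C)ᗮ.starProjection (x : X), Submodule.starProjection_apply_mem _ _, hd⟩, ?_, ?_⟩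
  · have h3 : (⟨_, hd⟩ : C.domain) = x - ⟨_, h1⟩ := Subtype.ext hs
    change C ⟨_, hd⟩ = y
    rw [h3, LinearPMap.map_sub, h2, sub_zero, hx]
  · exact (Submodule.norm_starProjection_apply_le _ _).trans hn

/-- Convergence of `C^⋄ Φ_n` in the dual norm forces convergence of the components of `Φ_n` in the
closed range `R`. -/
theorem exists_tendsto_starProjection_of_diamond [CompleteSpace Y] {C : X →ₗ.[𝕜] Y}
    {R : Submodule 𝕜 Y} [R.HasOrthogonalProjection] (hR : ran C ≤ R) {c : ℝ}
    (hbelow : ∀ Φ, ‖R.starProjection Φ‖ ≤ c * ‖diamond C Φ‖) {Φ : ℕ → Y} {f : Hneg1 C}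
    (hf : Tendsto (fun n => diamond C (Φ n)) atTop (𝓝 f)) :
    ∃ d ∈ R, diamond C d = f ∧ Tendsto (fun n => R.starProjection (Φ n)) atTop (𝓝 d) := by
  have hcau : CauchySeq fun n => R.starProjection (Φ n) := by
    rw [cauchySeq_iff_tendsto_dist_atTop_0]
    have h1 : Tendsto (fun p : ℕ × ℕ => c * ‖diamond C (Φ p.1) - diamond C (Φ p.2)‖) atTop
        (𝓝 0) := by
      rw [← prod_atTop_atTop_eq]
      have h0 : c * ‖f - f‖ = 0 := by
        have : ‖(0 : Hneg1 C)‖ = 0 := norm_zero (E := Hneg1 C)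
        rw [sub_self, this, mul_zero]
      rw [← h0]
      exact (Tendsto.norm (E := Hneg1 C) ((hf.comp tendsto_fst).sub
        (hf.comp tendsto_snd)) (l := atTop ×ˢ atTop)).const_mul c
    refine squeeze_zero (fun _ => dist_nonneg) (fun n => ?_) h1
    rw [dist_eq_norm, ← map_sub, ← diamond_sub]
    exact hbelow _
  obtain ⟨d, hd⟩ := cauchySeq_tendsto_of_complete hcau
  have hcl : IsClosed (R : Set Y) := by
    rw [← Submodule.orthogonal_orthogonal R]
    exact Submodule.isClosed_orthogonal _
  refine ⟨d, hcl.mem_of_tendsto hd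
    (Eventually.of_forall fun n => R.starProjection_apply_mem _), ?_, hd⟩
  refine tendsto_nhds_unique ((continuous_diamond C).tendsto d |>.comp hd) ?_
  refine hf.congr fun n => ?_
  exact (diamond_starProjection hR _).symm

end ClosedRange

/-! ### Schur components and convergence in the topology `tauB` -/

section SchurComponents

variable {𝕜 X : Type*} [RCLike 𝕜]
  [NormedAddCommGroup X] [InnerProductSpace 𝕜 X]
  {H0 : Submodule 𝕜 X} [H0.HasOrthogonalProjection]

theorem block_apply (V W : Submodule 𝕜 X) [W.HasOrthogonalProjection] (a : X →L[𝕜] X) (v : V) :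
    block V W a v = W.orthogonalProjectionOnto (a v) := rfl

theorem s00_block {a : X →L[𝕜] X} (ha : IsUnit (block H0 H0 a)) (v : H0) :
    s00 H0 a (block H0 H0 a v) = v :=
  congrArg (fun T : H0 →L[𝕜] H0 => T v) (Ring.inverse_mul_cancel _ ha)

theorem block_s00 {a : X →L[𝕜] X} (ha : IsUnit (block H0 H0 a)) (v : H0) :
    block H0 H0 a (s00 H0 a v) = v :=
  congrArg (fun T : H0 →L[𝕜] H0 => T v) (Ring.mul_inverse_cancel _ ha)

theorem s01_apply (a : X →L[𝕜] X) (y : H0ᗮ) :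
    s01 H0 a y = s00 H0 a (block H0ᗮ H0 a y) := rfl

theorem s10_apply (a : X →L[𝕜] X) (y : H0) :
    s10 H0 a y = block H0 H0ᗮ a (s00 H0 a y) := rfl

theorem s11_apply (a : X →L[𝕜] X) (y : H0ᗮ) :
    s11 H0 a y = block H0ᗮ H0ᗮ a y - block H0 H0ᗮ a (s01 H0 a y) := rfl

theorem coe_proj_add_coe_proj_orthogonal (E : X) :
    (H0.orthogonalProjectionOnto E : X) + (H0ᗮ.orthogonalProjectionOnto E : X) = E :=
  H0.starProjection_add_starProjection_orthogonal E

theorem proj_apply_eq_block_add (W : Submodule 𝕜 X) [W.HasOrthogonalProjection]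
    (a : X →L[𝕜] X) (E : X) :
    W.orthogonalProjectionOnto (a E) = block H0 W a (H0.orthogonalProjectionOnto E)
      + block H0ᗮ W a (H0ᗮ.orthogonalProjectionOnto E) := by
  conv_lhs => rw [← coe_proj_add_coe_proj_orthogonal (H0 := H0) E]
  rw [map_add, map_add]
  rfl

/-- The `H0`-component of `E` in terms of the `H0`-component of `a E` and the `H0ᗮ`-component
of `E`. -/
theorem proj_eq_schur {a : X →L[𝕜] X} (ha : IsUnit (block H0 H0 a)) (E : X) :
    H0.orthogonalProjectionOnto E = s00 H0 a (H0.orthogonalProjectionOnto (a E))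
      - s01 H0 a (H0ᗮ.orthogonalProjectionOnto E) := by
  rw [proj_apply_eq_block_add (H0 := H0), map_add, s00_block ha, s01_apply, add_sub_cancel_right]

/-- The `H0ᗮ`-component of `a E` in terms of the `H0`-component of `a E` and the `H0ᗮ`-component
of `E`. -/
theorem proj_orthogonal_apply_eq_schur {a : X →L[𝕜] X} (ha : IsUnit (block H0 H0 a)) (E : X) :
    H0ᗮ.orthogonalProjectionOnto (a E) = s10 H0 a (H0.orthogonalProjectionOnto (a E))
      + s11 H0 a (H0ᗮ.orthogonalProjectionOnto E) := by
  have h := proj_eq_schur ha E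
  rw [proj_apply_eq_block_add (H0 := H0) H0ᗮ, h, map_sub, s10_apply, s11_apply]
  abel

/-- Mixed data determine a vector: the element with `H0ᗮ`-component `y` whose image under `a` has
`H0`-component `d`. -/
theorem proj_apply_of_schur {a : X →L[𝕜] X} (ha : IsUnit (block H0 H0 a)) (d : H0) (y : H0ᗮ) :
    H0.orthogonalProjectionOnto (a ((s00 H0 a d - s01 H0 a y : H0) + (y : X))) = d := by
  rw [map_add, map_add]
  change block H0 H0 a (s00 H0 a d - s01 H0 a y) + block H0ᗮ H0 a y = d
  rw [map_sub, s01_apply, block_s00 ha, block_s00 ha, sub_add_cancel]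

theorem proj_coe_add_coe (v : H0) (y : H0ᗮ) :
    H0.orthogonalProjectionOnto ((v : X) + y) = v := by
  rw [map_add, Submodule.orthogonalProjectionOnto_mem_subspace_eq_self,
    Submodule.orthogonalProjectionOnto_apply_of_mem_orthogonal y.2, add_zero]

theorem proj_orthogonal_coe_add_coe (v : H0) (y : H0ᗮ) :
    H0ᗮ.orthogonalProjectionOnto ((v : X) + y) = y := by
  rw [map_add, Submodule.orthogonalProjectionOnto_mem_subspace_eq_self,
    Submodule.orthogonalProjectionOnto_orthogonal_apply_eq_zero v.2, zero_add]

variable (H0) in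
/-- The four Schur components of an operator, jointly, each target carrying its weak operator
topology. -/
noncomputable def schurMap (a : MSet H0) :
    (H0 →WOT[𝕜] H0) × (H0ᗮ →WOT[𝕜] H0) × (H0 →WOT[𝕜] H0ᗮ) × (H0ᗮ →WOT[𝕜] H0ᗮ) :=
  (.ofCLM (s00 H0 a.1), .ofCLM (s01 H0 a.1), .ofCLM (s10 H0 a.1), .ofCLM (s11 H0 a.1))

theorem tau_eq_induced : tau H0 = .induced (schurMap H0) inferInstance := by
  simp only [tau, instTopologicalSpaceProd, induced_inf, induced_compose, inf_assoc]
  rfl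

theorem tauB_le_tau : tauB H0 ≤ tau H0 :=
  iSup₂_le fun _ _ => coinduced_le_iff_le_induced.2 le_rfl

/-- The largest of the norms of the four Schur components. -/
noncomputable def schurNorm (a : X →L[𝕜] X) : ℝ :=
  max (max ‖s00 H0 a‖ ‖s01 H0 a‖) (max ‖s10 H0 a‖ ‖s11 H0 a‖)

theorem mem_MBall_iff {r : ℝ} {a : MSet H0} : a ∈ MBall H0 r ↔ schurNorm (H0 := H0) a.1 ≤ r := by
  simp only [MBall, schurNorm, Set.mem_ofPred_eq, max_le_iff, and_assoc]

theorem schurNorm_eq_of_schurMap_eq {a b : MSet H0} (h : schurMap H0 a = schurMap H0 b) :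
    schurNorm (H0 := H0) a.1 = schurNorm (H0 := H0) b.1 := by
  simp only [schurMap, Prod.mk.injEq, ContinuousLinearMapWOT.ofCLM_injective.eq_iff] at h
  obtain ⟨h1, h2, h3, h4⟩ := h
  rw [schurNorm, schurNorm, h1, h2, h3, h4]

/-- A set that meets every ball in finitely many fibres of the Schur components is closed in
`tauB`: within each ball it is a finite union of `tau`-closed sets. -/
theorem isOpen_tauB_compl_of_finite {a : ℕ → MSet H0}
    (hfin : ∀ r : ℝ, {k | schurNorm (H0 := H0) (a k).1 ≤ r}.Finite) :
    IsOpen[tauB H0] {c | ∃ k, schurMap H0 c = schurMap H0 (a k)}ᶜ := by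
  rw [isOpen_iSup_iff]
  intro r
  rw [isOpen_iSup_iff]
  intro _
  rw [isOpen_coinduced]
  let F := {k | schurNorm (H0 := H0) (a k).1 ≤ r}
  let Z : Set ((H0 →WOT[𝕜] H0) × (H0ᗮ →WOT[𝕜] H0) × (H0 →WOT[𝕜] H0ᗮ) × (H0ᗮ →WOT[𝕜] H0ᗮ)) :=
    (fun k => schurMap H0 (a k)) '' F
  have hZ : IsOpen Zᶜ := ((hfin r).image _).isClosed.isOpen_compl
  refine (@isOpen_induced_iff _ _ (tau H0) _ _).2 ⟨schurMap H0 ⁻¹' Zᶜ, ?_, ?_⟩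
  · rw [tau_eq_induced]
    exact isOpen_induced_iff.2 ⟨_, hZ, rfl⟩
  · ext c
    simp only [Set.mem_preimage, Set.mem_compl_iff, not_iff_not, Set.mem_ofPred_eq]
    constructor
    · rintro ⟨k, -, hk⟩
      exact ⟨k, hk.symm⟩
    · rintro ⟨k, hk⟩
      refine ⟨k, ?_, hk.symm⟩
      change _ ≤ r
      rw [← schurNorm_eq_of_schurMap_eq hk]
      exact mem_MBall_iff.1 c.2

/-- A sequence converging in `tauB` is eventually contained in a single ball. -/
theorem exists_eventually_mem_MBall {a : ℕ → MSet H0} {b : MSet H0}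
    (h : Tendsto a atTop (@nhds _ (tauB H0) b)) :
    ∃ r : ℝ, ∀ᶠ n in atTop, a n ∈ MBall H0 r := by
  by_contra! hcon
  -- a subsequence of unbounded norms, all larger than the norm of the limit, would leave a
  -- neighbourhood of the limit
  obtain ⟨φ, hφ, hφn⟩ := extraction_forall_of_frequently
    (P := fun k n => schurNorm (H0 := H0) b.1 + k < schurNorm (H0 := H0) (a n).1)
    (fun k => (hcon (schurNorm (H0 := H0) b.1 + k)).mono
      fun n hn => not_le.1 fun hle => hn (mem_MBall_iff.2 hle))
  have hfin : ∀ r : ℝ, {k | schurNorm (H0 := H0) (a (φ k)).1 ≤ r}.Finite := fun r => by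
    obtain ⟨K, hK⟩ := exists_nat_ge (r - schurNorm (H0 := H0) b.1)
    refine (Set.finite_Iic K).subset fun k hk => ?_
    have h1 : schurNorm (H0 := H0) b.1 + k < r := (hφn k).trans_le hk
    have h2 : (k : ℝ) ≤ K := by linarith
    exact_mod_cast h2
  have hopen := isOpen_tauB_compl_of_finite (a := fun k => a (φ k)) hfin
  have hb : b ∈ {c | ∃ k, schurMap H0 c = schurMap H0 (a (φ k))}ᶜ := by
    rintro ⟨k, hk⟩
    have h1 := hφn k
    rw [← schurNorm_eq_of_schurMap_eq hk] at h1
    linarith [(Nat.cast_nonneg k : (0 : ℝ) ≤ k)]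
  have hev := h (@IsOpen.mem_nhds _ (tauB H0) _ _ hopen hb)
  obtain ⟨k, hk⟩ := (hφ.tendsto_atTop.eventually hev).exists
  exact hk ⟨k, rfl⟩

theorem tendsto_schurMap {a : ℕ → MSet H0} {b : MSet H0}
    (h : Tendsto a atTop (@nhds _ (tauB H0) b)) :
    Tendsto (fun n => schurMap H0 (a n)) atTop (𝓝 (schurMap H0 b)) := by
  have h1 : Tendsto a atTop (@nhds _ (tau H0) b) := h.mono_right (nhds_mono tauB_le_tau)
  rw [tau_eq_induced, nhds_induced] at h1
  exact tendsto_comap_iff.1 h1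

end SchurComponents

/-! ### Weak convergence -/

section Weak

variable {𝕜 X Y : Type*} [RCLike 𝕜]
  [NormedAddCommGroup X] [InnerProductSpace 𝕜 X]
  [NormedAddCommGroup Y] [InnerProductSpace 𝕜 Y]

theorem WeaklyTendsto.of_tendsto {u : ℕ → X} {u' : X} (h : Tendsto u atTop (𝓝 u')) :
    WeaklyTendsto (𝕜 := 𝕜) u u' := fun _ => tendsto_const_nhds.inner h

theorem WeaklyTendsto.add {u v : ℕ → X} {u' v' : X} (hu : WeaklyTendsto (𝕜 := 𝕜) u u')
    (hv : WeaklyTendsto (𝕜 := 𝕜) v v') :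
    WeaklyTendsto (𝕜 := 𝕜) (fun n => u n + v n) (u' + v') := fun φ => by
  simpa only [inner_add_right] using (hu φ).add (hv φ)

theorem WeaklyTendsto.sub {u v : ℕ → X} {u' v' : X} (hu : WeaklyTendsto (𝕜 := 𝕜) u u')
    (hv : WeaklyTendsto (𝕜 := 𝕜) v v') :
    WeaklyTendsto (𝕜 := 𝕜) (fun n => u n - v n) (u' - v') := fun φ => by
  simpa only [inner_sub_right] using (hu φ).sub (hv φ)

theorem WeaklyTendsto.map [CompleteSpace X] [CompleteSpace Y] {u : ℕ → X} {u' : X}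
    (hu : WeaklyTendsto (𝕜 := 𝕜) u u') (T : X →L[𝕜] Y) :
    WeaklyTendsto (𝕜 := 𝕜) (fun n => T (u n)) (T u') := fun φ => by
  simpa only [ContinuousLinearMap.adjoint_inner_left] using hu (ContinuousLinearMap.adjoint T φ)

theorem tendsto_inner_of_weaklyTendsto {u v : ℕ → X} {u' v' : X} (hu : Tendsto u atTop (𝓝 u'))
    (hv : WeaklyTendsto (𝕜 := 𝕜) v v') {r : ℝ} (hr : ∀ᶠ n in atTop, ‖v n‖ ≤ r) :
    Tendsto (fun n => inner 𝕜 (u n) (v n)) atTop (𝓝 (inner 𝕜 u' v')) := by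
  have h0 : Tendsto (fun n => inner 𝕜 (u n - u') (v n)) atTop (𝓝 0) := by
    have h1 : Tendsto (fun n => ‖u n - u'‖ * r) atTop (𝓝 0) := by
      simpa using (tendsto_iff_norm_sub_tendsto_zero.1 hu).mul_const r
    refine squeeze_zero_norm' (hr.mono fun n hn => ?_) h1
    exact (norm_inner_le_norm _ _).trans (mul_le_mul_of_nonneg_left hn (norm_nonneg _))
  have := h0.add (hv u')
  rw [zero_add] at this
  refine this.congr fun n => ?_
  rw [inner_sub_left, sub_add_cancel]

theorem tendsto_inner_of_weaklyTendsto' {u v : ℕ → X} {u' v' : X}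
    (hu : WeaklyTendsto (𝕜 := 𝕜) u u') {r : ℝ} (hr : ∀ᶠ n in atTop, ‖u n‖ ≤ r)
    (hv : Tendsto v atTop (𝓝 v')) :
    Tendsto (fun n => inner 𝕜 (u n) (v n)) atTop (𝓝 (inner 𝕜 u' v')) := by
  simpa only [Function.comp_def, inner_conj_symm] using
    (RCLike.continuous_conj.tendsto _).comp (tendsto_inner_of_weaklyTendsto hv hu hr)

/-- Bounded convergence in the weak operator topology, applied to a norm convergent sequence. -/
theorem WeaklyTendsto.of_WOT [CompleteSpace Y] {A : ℕ → X →L[𝕜] Y} {A' : X →L[𝕜] Y}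
    (hA : Tendsto (fun n => ContinuousLinearMapWOT.ofCLM (A n)) atTop
      (𝓝 (ContinuousLinearMapWOT.ofCLM A'))) {r : ℝ} (hr : ∀ᶠ n in atTop, ‖A n‖ ≤ r)
    {x : ℕ → X} {x' : X} (hx : Tendsto x atTop (𝓝 x')) :
    WeaklyTendsto (𝕜 := 𝕜) (fun n => A n (x n)) (A' x') := by
  intro φ
  have h1 := ContinuousLinearMapWOT.tendsto_iff_forall_inner_apply_tendsto.1 hA x' φ
  have h2 : Tendsto (fun n => A n (x n - x')) atTop (𝓝 0) := by
    have h3 : Tendsto (fun n => r * ‖x n - x'‖) atTop (𝓝 0) := by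
      simpa using (tendsto_iff_norm_sub_tendsto_zero.1 hx).const_mul r
    exact squeeze_zero_norm' (hr.mono fun n hn => (A n).le_of_opNorm_le hn _) h3
  have h5 : Tendsto (fun n => inner 𝕜 φ (A n (x n - x'))) atTop (𝓝 (inner 𝕜 φ 0)) :=
    tendsto_const_nhds.inner h2
  have h6 := h5.add h1
  rw [inner_zero_right, zero_add] at h6
  refine h6.congr fun n => ?_
  rw [ContinuousLinearMapWOT.ofCLM_apply, map_sub, inner_sub_right, sub_add_cancel]

theorem exists_eventually_norm_apply_le {A : ℕ → X →L[𝕜] Y} {r : ℝ}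
    (hr : ∀ᶠ n in atTop, ‖A n‖ ≤ r) {x : ℕ → X} {x' : X} (hx : Tendsto x atTop (𝓝 x')) :
    ∃ R : ℝ, ∀ᶠ n in atTop, ‖A n (x n)‖ ≤ R := by
  refine ⟨r * (‖x'‖ + 1), ?_⟩
  filter_upwards [hr, hx.norm.eventually_le_const (lt_add_one ‖x'‖)] with n h1 h2
  exact ((A n).le_opNorm _).trans
    (mul_le_mul h1 h2 (norm_nonneg _) ((norm_nonneg _).trans h1))

theorem WeaklyTendsto.tendsto [FiniteDimensional 𝕜 X] {u : ℕ → X} {u' : X}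
    (h : WeaklyTendsto (𝕜 := 𝕜) u u') : Tendsto u atTop (𝓝 u') := by
  let b := stdOrthonormalBasis 𝕜 X
  have h1 : Tendsto (fun n => ∑ i, inner 𝕜 (b i) (u n) • b i) atTop
      (𝓝 (∑ i, inner 𝕜 (b i) u' • b i)) :=
    tendsto_finsetSum _ fun i _ => (h (b i)).smul_const _
  simpa only [b.sum_repr'] using h1

theorem tendsto_of_forall_apply [FiniteDimensional 𝕜 X] {M : ℕ → X →L[𝕜] Y} {M' : X →L[𝕜] Y}
    (h : ∀ z, Tendsto (fun n => M n z) atTop (𝓝 (M' z))) : Tendsto M atTop (𝓝 M') := by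
  let b := Module.finBasis 𝕜 X
  obtain ⟨C, hC, hb⟩ := b.exists_opNorm_le (F := Y)
  rw [tendsto_iff_norm_sub_tendsto_zero]
  have h1 : Tendsto (fun n => C * ∑ i, ‖M n (b i) - M' (b i)‖) atTop (𝓝 0) := by
    have := (tendsto_finsetSum Finset.univ
      fun i _ => tendsto_iff_norm_sub_tendsto_zero.1 (h (b i))).const_mul C
    simpa using this
  refine squeeze_zero (fun _ => norm_nonneg _) (fun n => ?_) h1
  refine hb (Finset.sum_nonneg fun _ _ => norm_nonneg _) fun i => ?_
  exact Finset.single_le_sum (f := fun i => ‖M n (b i) - M' (b i)‖)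
    (fun _ _ => norm_nonneg _) (Finset.mem_univ i)

/-- In finite dimensions, the solutions of `M_n y_n = r_n` converge as soon as the data do and the
limit operator is injective. -/
theorem exists_tendsto_solution [FiniteDimensional 𝕜 X] {M : ℕ → X →L[𝕜] X} {M' : X →L[𝕜] X}
    (hM : ∀ z, Tendsto (fun n => M n z) atTop (𝓝 (M' z))) (hinj : ∀ z, M' z = 0 → z = 0)
    {y r : ℕ → X} {r' : X} (hy : ∀ n, M n (y n) = r n) (hr : Tendsto r atTop (𝓝 r')) :
    ∃ y', M' y' = r' ∧ Tendsto y atTop (𝓝 y') := by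
  have := FiniteDimensional.complete 𝕜 X
  have hnorm := tendsto_of_forall_apply hM
  have hunit : IsUnit M' := by
    have hi : Function.Injective M'.toLinearMap :=
      LinearMap.ker_eq_bot.1 (LinearMap.ker_eq_bot'.2 hinj)
    let e : X ≃L[𝕜] X := (LinearEquiv.ofInjectiveEndo M'.toLinearMap hi).toContinuousLinearEquiv
    exact ⟨ContinuousLinearEquiv.toUnit e, by ext; rfl⟩
  have hinv : Tendsto (fun n => Ring.inverse (M n)) atTop (𝓝 (Ring.inverse M')) := by
    obtain ⟨U, hU⟩ := hunit
    rw [← hU] at hnorm ⊢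
    exact Tendsto.comp (NormedRing.inverse_continuousAt U).tendsto hnorm
  refine ⟨Ring.inverse M' r',
    congrArg (fun T : X →L[𝕜] X => T r') (Ring.mul_inverse_cancel _ hunit), ?_⟩
  refine Tendsto.congr' ?_ ((isBoundedBilinearMap_apply.continuous.tendsto
    (Ring.inverse M', r')).comp (hinv.prodMk_nhds hr))
  filter_upwards [hnorm.eventually (Units.isOpen.mem_nhds hunit)] with n hn
  change Ring.inverse (M n) (r n) = y n
  rw [← hy n]
  exact congrArg (fun T : X →L[𝕜] X => T (y n)) (Ring.inverse_mul_cancel _ hn)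

end Weak

/-! ### The div-curl system in a Hilbert space split as `G ⊕ C ⊕ N` -/

section Solution

variable {𝕜 X : Type*} [RCLike 𝕜]
  [NormedAddCommGroup X] [InnerProductSpace 𝕜 X]

/-- Admissibility of a coefficient relative to two closed subspaces `G` (the gradients) and `C` (the
rotations): the operator, its compression to `G`, and the compression of its inverse to `C` are
invertible. -/
structure AdmissibleFor (G C : Submodule 𝕜 X) [G.HasOrthogonalProjection]
    [C.HasOrthogonalProjection] (a : X →L[𝕜] X) : Prop where
  isUnit : IsUnit a
  isUnit_block : IsUnit (block G G a)
  isUnit_block_inverse : IsUnit (block C C (Ring.inverse a))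

/-- The coefficient-dependent harmonic fields `{h ∈ Cᗮ | a h ∈ Gᗮ}`. -/
def harmonic (G C : Submodule 𝕜 X) (a : X →L[𝕜] X) : Submodule 𝕜 X :=
  Gᗮ.comap a.toLinearMap ⊓ Cᗮ

/-- The complement `G + a⁻¹ C` of the harmonic fields. -/
noncomputable def potential (G C : Submodule 𝕜 X) (a : X →L[𝕜] X) : Submodule 𝕜 X :=
  G ⊔ C.map (Ring.inverse a).toLinearMap

variable {G C N : Submodule 𝕜 X} {a : X →L[𝕜] X}

theorem inverse_apply_apply (ha : IsUnit a) (v : X) : Ring.inverse a (a v) = v :=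
  congrArg (fun T : X →L[𝕜] X => T v) (Ring.inverse_mul_cancel _ ha)

theorem apply_inverse_apply (ha : IsUnit a) (v : X) : a (Ring.inverse a v) = v :=
  congrArg (fun T : X →L[𝕜] X => T v) (Ring.mul_inverse_cancel _ ha)

theorem proj_eq_zero_of_mem_orthogonal {V : Submodule 𝕜 X} [V.HasOrthogonalProjection] {v : X}
    (hv : v ∈ Vᗮ) : V.orthogonalProjectionOnto v = 0 :=
  Submodule.orthogonalProjectionOnto_apply_of_mem_orthogonal hv

theorem mem_orthogonal_of_proj_eq_zero {V : Submodule 𝕜 X} [V.HasOrthogonalProjection] {v : X}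
    (hv : V.orthogonalProjectionOnto v = 0) : v ∈ Vᗮ :=
  Submodule.orthogonalProjectionOnto_eq_zero_iff.1 hv

theorem coe_proj_of_mem {V : Submodule 𝕜 X} [V.HasOrthogonalProjection] {v : X}
    (hv : v ∈ V) : (V.orthogonalProjectionOnto v : X) = v :=
  Submodule.starProjection_eq_self_iff.2 hv

theorem eq_zero_of_mem_of_mem_orthogonal {V : Submodule 𝕜 X} {y : X} (h1 : y ∈ V) (h2 : y ∈ Vᗮ) :
    y = 0 := by
  rw [← Submodule.mem_bot 𝕜, ← Submodule.inf_orthogonal_eq_bot V]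
  exact ⟨h1, h2⟩

theorem le_orthogonal_symm (hGC : C ≤ Gᗮ) : G ≤ Cᗮ :=
  (Submodule.le_orthogonal_orthogonal G).trans (Submodule.orthogonal_le hGC)

theorem mem_potential {w : X} :
    w ∈ potential G C a ↔ ∃ v ∈ G, ∃ c ∈ C, w = v + Ring.inverse a c := by
  simp only [potential, Submodule.mem_sup, Submodule.mem_map]
  constructor
  · rintro ⟨v, hv, _, ⟨c, hc, rfl⟩, rfl⟩
    exact ⟨v, hv, c, hc, rfl⟩
  · rintro ⟨v, hv, c, hc, rfl⟩
    exact ⟨v, hv, _, ⟨c, hc, rfl⟩, rfl⟩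

variable [G.HasOrthogonalProjection] [C.HasOrthogonalProjection] [N.HasOrthogonalProjection]

/-- An element of `a⁻¹ C` without component in `C` vanishes. -/
theorem AdmissibleFor.eq_zero_of_apply_mem (ha : AdmissibleFor G C a) {w : X} (hw : a w ∈ C)
    (h0 : w ∈ Cᗮ) : w = 0 := by
  have h1 : block C C (Ring.inverse a) ⟨a w, hw⟩ = 0 := by
    rw [block_apply]
    change C.orthogonalProjectionOnto (Ring.inverse a (a w)) = 0
    rw [inverse_apply_apply ha.isUnit, proj_eq_zero_of_mem_orthogonal h0]
  have h2 : (⟨a w, hw⟩ : C) = 0 := by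
    have := congrArg (fun T : C →L[𝕜] C => T ⟨a w, hw⟩)
      (Ring.inverse_mul_cancel _ ha.isUnit_block_inverse)
    change Ring.inverse (block C C (Ring.inverse a)) (block C C (Ring.inverse a) _) = _ at this
    rw [h1, map_zero] at this
    exact this.symm
  have h3 : a w = 0 := congrArg Subtype.val h2
  rw [← inverse_apply_apply ha.isUnit w, h3, map_zero]

theorem AdmissibleFor.eq_zero_of_mem_of_apply_mem (ha : AdmissibleFor G C a) {v : X} (hv : v ∈ G)
    (h0 : a v ∈ Gᗮ) : v = 0 := by
  have h1 : block G G a ⟨v, hv⟩ = 0 := by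
    rw [block_apply]
    exact proj_eq_zero_of_mem_orthogonal h0
  have h2 := s00_block ha.isUnit_block ⟨v, hv⟩
  rw [h1, map_zero] at h2
  exact (congrArg Subtype.val h2).symm

/-- The direct decomposition of the space into the harmonic fields of `a` and `G ∔ a⁻¹ C`. -/
theorem AdmissibleFor.isCompl (ha : AdmissibleFor G C a) (hGC : C ≤ Gᗮ) :
    IsCompl (harmonic G C a) (potential G C a) := by
  have hCG := le_orthogonal_symm hGC
  constructor
  · rw [Submodule.disjoint_def]
    rintro h ⟨h1, h2⟩ hw
    obtain ⟨v, hv, c, hc, rfl⟩ := mem_potential.1 hw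
    have h3 : Ring.inverse a c ∈ Cᗮ := by
      have := Cᗮ.sub_mem h2 (hCG hv)
      rwa [add_sub_cancel_left] at this
    have h4 : Ring.inverse a c = 0 :=
      ha.eq_zero_of_apply_mem (by rwa [apply_inverse_apply ha.isUnit]) h3
    rw [h4, add_zero] at h1 ⊢
    exact ha.eq_zero_of_mem_of_apply_mem hv h1
  · rw [codisjoint_iff, Submodule.eq_top_iff']
    intro E
    -- remove the component in `C` by an element of `a⁻¹ C`, then the flux in `G` by one of `G`
    let c : C := Ring.inverse (block C C (Ring.inverse a)) (C.orthogonalProjectionOnto E)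
    have hc : C.orthogonalProjectionOnto (Ring.inverse a c) = C.orthogonalProjectionOnto E :=
      congrArg (fun T : C →L[𝕜] C => T (C.orthogonalProjectionOnto E))
        (Ring.mul_inverse_cancel _ ha.isUnit_block_inverse)
    let E' := E - Ring.inverse a c
    have hE' : E' ∈ Cᗮ := mem_orthogonal_of_proj_eq_zero (by rw [map_sub, hc, sub_self])
    let v : G := s00 G a (G.orthogonalProjectionOnto (a E'))
    have hv : G.orthogonalProjectionOnto (a v) = G.orthogonalProjectionOnto (a E') :=
      block_s00 ha.isUnit_block _
    refine Submodule.mem_sup.2 ⟨E' - v, ⟨?_, Cᗮ.sub_mem hE' (hCG v.2)⟩, v + Ring.inverse a c,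
      mem_potential.2 ⟨v, v.2, c, c.2, rfl⟩, ?_⟩
    · refine mem_orthogonal_of_proj_eq_zero ?_
      change G.orthogonalProjectionOnto (a (E' - v)) = 0
      rw [map_sub, map_sub, hv, sub_self]
    · simp only [E']
      abel

/-- The element `y - a₀₀⁻¹ a₀₁ y`, whose flux has no component in `G` and equals the Schur
complement applied to `y`. -/
theorem apply_coe_sub_s01 (ha : IsUnit (block G G a)) (y : Gᗮ) :
    a ((y : X) - s01 G a y) = s11 G a y := by
  have h1 : (y : X) - s01 G a y = ((s00 G a 0 - s01 G a y : G) : X) + y := by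
    rw [map_zero, zero_sub, Submodule.coe_neg]
    abel
  have h2 := proj_orthogonal_apply_eq_schur (H0 := G) ha ((y : X) - s01 G a y)
  have h3 : G.orthogonalProjectionOnto (a ((y : X) - s01 G a y)) = 0 := by
    rw [h1, proj_apply_of_schur ha]
  rw [h3, map_zero, zero_add, h1, proj_orthogonal_coe_add_coe] at h2
  rw [← coe_proj_add_coe_proj_orthogonal (H0 := G) (a ((y : X) - s01 G a y)), h3, h1, h2]
  simp

theorem mem_of_proj_eq_zero {G C N : Submodule 𝕜 X} [C.HasOrthogonalProjection]
    [N.HasOrthogonalProjection] (hGC : C ≤ Gᗮ) (hN : N = Gᗮ ⊓ Cᗮ) {v : X} (hv : v ∈ Gᗮ)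
    (h0 : N.orthogonalProjectionOnto v = 0) :
    v ∈ C := by
  have h1 : v - C.starProjection v ∈ N := by
    rw [hN]
    exact ⟨Gᗮ.sub_mem hv (hGC (C.starProjection_apply_mem v)),
      C.sub_starProjection_mem_orthogonal v⟩
  have h2 : v - C.starProjection v ∈ Nᗮ := by
    refine Nᗮ.sub_mem (mem_orthogonal_of_proj_eq_zero h0) ?_
    rw [Submodule.mem_orthogonal]
    intro n hn
    rw [hN] at hn
    exact (Submodule.mem_orthogonal' _ _).1 hn.2 _ (C.starProjection_apply_mem v)
  have h3 := eq_zero_of_mem_of_mem_orthogonal h1 h2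
  rw [sub_eq_zero.1 h3]
  exact C.starProjection_apply_mem v

theorem coe_proj_orthogonal_eq_add (hGC : C ≤ Gᗮ) (hN : N = Gᗮ ⊓ Cᗮ) (E : X) :
    (Gᗮ.orthogonalProjectionOnto E : X)
      = C.orthogonalProjectionOnto E + N.orthogonalProjectionOnto E := by
  have hNG : N ≤ Gᗮ := hN ▸ inf_le_left
  have h1 := C.orthogonalProjectionOnto_starProjection_of_le hGC E
  have h2 := N.orthogonalProjectionOnto_starProjection_of_le hNG E
  set q := Gᗮ.starProjection E with hq
  have hqG : q ∈ Gᗮ := Gᗮ.starProjection_apply_mem E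
  change q = _
  have h3 : q - C.orthogonalProjectionOnto q ∈ N := by
    rw [hN]
    exact ⟨Gᗮ.sub_mem hqG (hGC (C.orthogonalProjectionOnto q).2),
      C.sub_starProjection_mem_orthogonal q⟩
  have h4 : N.orthogonalProjectionOnto (C.orthogonalProjectionOnto q : X) = 0 :=
    proj_eq_zero_of_mem_orthogonal <| by
      rw [Submodule.mem_orthogonal]
      intro n hn
      rw [hN] at hn
      exact (Submodule.mem_orthogonal' _ _).1 hn.2 _ (C.orthogonalProjectionOnto q).2
  have h5 := coe_proj_of_mem h3
  rw [map_sub, h4, sub_zero] at h5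
  rw [← h1, ← h2, h5]
  abel

/-- The third equation of the div-curl system, expressed by the Schur complement: the projection of
`E` onto the harmonic fields of `a` has `N`-component `x` if and only if the Schur complement maps
`E₁ - x` into `C`, where `E₁` is the component of `E` in `Gᗮ`. -/
theorem AdmissibleFor.proj_projection_eq_iff (ha : AdmissibleFor G C a) (hGC : C ≤ Gᗮ)
    (hN : N = Gᗮ ⊓ Cᗮ) (E : X) (x : N) (x₁ : Gᗮ) (hx₁ : (x₁ : X) = x) :
    N.orthogonalProjectionOnto
        ((harmonic G C a).projection (potential G C a) (ha.isCompl hGC) E) = x ↔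
      N.orthogonalProjectionOnto
        (s11 G a (Gᗮ.orthogonalProjectionOnto E - x₁) : X) = 0 := by
  have hCG := le_orthogonal_symm hGC
  have hNG : N ≤ Gᗮ := hN ▸ inf_le_left
  have hNC : N ≤ Cᗮ := hN ▸ inf_le_right
  constructor
  · intro hx
    set h := (harmonic G C a).projection (potential G C a) (ha.isCompl hGC) E with hh
    have hmem : h ∈ harmonic G C a := Submodule.projection_apply_mem _ _
    obtain ⟨v, hv, c, hc, hw⟩ := mem_potential.1 (Submodule.sub_projection_mem (ha.isCompl hGC) E)
    have hQh : Gᗮ.orthogonalProjectionOnto h = x₁ := by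
      refine Subtype.ext ?_
      rw [coe_proj_orthogonal_eq_add hGC hN, hx, proj_eq_zero_of_mem_orthogonal hmem.2, hx₁]
      simp
    have hQ : Gᗮ.orthogonalProjectionOnto E - x₁
        = Gᗮ.orthogonalProjectionOnto (v + Ring.inverse a c) := by
      rw [← hw, map_sub, ← hQh]
    have h1 := proj_orthogonal_apply_eq_schur (H0 := G) ha.isUnit_block (v + Ring.inverse a c)
    have h2 := proj_orthogonal_apply_eq_schur (H0 := G) ha.isUnit_block v
    have h3 : Gᗮ.orthogonalProjectionOnto v = 0 :=
      Submodule.orthogonalProjectionOnto_orthogonal_apply_eq_zero hv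
    have h4 : G.orthogonalProjectionOnto c = 0 := proj_eq_zero_of_mem_orthogonal (hGC hc)
    rw [map_add a, apply_inverse_apply ha.isUnit, map_add, map_add, h4, add_zero, h2, h3, map_zero,
      add_zero, add_right_inj] at h1
    rw [hQ, ← h1, coe_proj_of_mem (hGC hc)]
    refine proj_eq_zero_of_mem_orthogonal ?_
    exact (Submodule.mem_orthogonal' _ _).2 fun n hn =>
      (Submodule.mem_orthogonal _ _).1 (hNC hn) c hc
  · intro h0
    set y := Gᗮ.orthogonalProjectionOnto E - x₁ with hy
    have hc : (s11 G a y : X) ∈ C := mem_of_proj_eq_zero hGC hN (s11 G a y).2 h0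
    -- `E` is the sum of the harmonic field `x - a₀₀⁻¹ a₀₁ x` and an element of `G + a⁻¹ C`
    have hharm : (x₁ : X) - s01 G a x₁ ∈ harmonic G C a := by
      refine ⟨?_, Cᗮ.sub_mem (hx₁ ▸ hNC x.2) (hCG (s01 G a x₁).2)⟩
      change a _ ∈ Gᗮ
      rw [apply_coe_sub_s01 ha.isUnit_block]
      exact (s11 G a x₁).2
    have hpot : (s00 G a (G.orthogonalProjectionOnto (a E)) : X) + ((y : X) - s01 G a y)
        ∈ potential G C a := by
      refine mem_potential.2 ⟨_, (s00 G a (G.orthogonalProjectionOnto (a E))).2, _, hc, ?_⟩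
      rw [← apply_coe_sub_s01 ha.isUnit_block, inverse_apply_apply ha.isUnit]
    have hE : E = ((x₁ : X) - s01 G a x₁)
        + ((s00 G a (G.orthogonalProjectionOnto (a E)) : X) + ((y : X) - s01 G a y)) := by
      conv_lhs => rw [← coe_proj_add_coe_proj_orthogonal (H0 := G) E,
        proj_eq_schur ha.isUnit_block E]
      have h1 : Gᗮ.orthogonalProjectionOnto E = x₁ + y := by rw [hy]; abel
      rw [h1, map_add]
      push_cast
      abel
    have hproj : (harmonic G C a).projection (potential G C a) (ha.isCompl hGC) E
        = (x₁ : X) - s01 G a x₁ := by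
      conv_lhs => rw [hE]
      rw [map_add, Submodule.projection_apply_of_mem_left _ hharm,
        (Submodule.projection_apply_eq_zero_iff _).2 hpot, add_zero]
    rw [hproj, map_sub, hx₁, Submodule.orthogonalProjectionOnto_mem_subspace_eq_self,
      proj_eq_zero_of_mem_orthogonal, sub_zero]
    exact (Submodule.mem_orthogonal' _ _).2 fun n hn =>
      (Submodule.mem_orthogonal _ _).1 (hNG hn) _ (s01 G a x₁).2

/-- The compression of the Schur complement to `N` is injective. -/
theorem AdmissibleFor.eq_zero_of_proj_s11 (ha : AdmissibleFor G C a) (hGC : C ≤ Gᗮ)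
    (hN : N = Gᗮ ⊓ Cᗮ) {z : Gᗮ} (hz : (z : X) ∈ N)
    (h0 : N.orthogonalProjectionOnto (s11 G a z : X) = 0) : z = 0 := by
  have hCG := le_orthogonal_symm hGC
  have hNC : N ≤ Cᗮ := hN ▸ inf_le_right
  have hc : (s11 G a z : X) ∈ C := mem_of_proj_eq_zero hGC hN (s11 G a z).2 h0
  rw [← apply_coe_sub_s01 ha.isUnit_block] at hc
  have h1 := ha.eq_zero_of_apply_mem hc (Cᗮ.sub_mem (hNC hz) (hCG (s01 G a z).2))
  have h2 : (z : X) = s01 G a z := sub_eq_zero.1 h1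
  exact Subtype.ext (eq_zero_of_mem_of_mem_orthogonal (h2 ▸ (s01 G a z).2) z.2)

/-- `E` has flux component `d` in `G`, component `k` in `C`, and its projection onto the harmonic
fields of `a` has component `x` in `N`. -/
structure SolvesFor (ha : AdmissibleFor G C a) (hGC : C ≤ Gᗮ) (d : G) (k : C) (x : N) (E : X) :
    Prop where
  proj_apply : G.orthogonalProjectionOnto (a E) = d
  proj_eq : C.orthogonalProjectionOnto E = k
  proj_projection : N.orthogonalProjectionOnto
    ((harmonic G C a).projection (potential G C a) (ha.isCompl hGC) E) = x

theorem SolvesFor.unique (hN : N = Gᗮ ⊓ Cᗮ) {ha : AdmissibleFor G C a} {hGC : C ≤ Gᗮ}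
    {d : G} {k : C} {x : N} {E F : X}
    (hE : SolvesFor ha hGC d k x E) (hF : SolvesFor ha hGC d k x F) : E = F := by
  have hNG : N ≤ Gᗮ := hN ▸ inf_le_left
  have h1 := (ha.proj_projection_eq_iff hGC hN E x ⟨x, hNG x.2⟩ rfl).1 hE.proj_projection
  have h2 := (ha.proj_projection_eq_iff hGC hN F x ⟨x, hNG x.2⟩ rfl).1 hF.proj_projection
  have h3 : Gᗮ.orthogonalProjectionOnto E - Gᗮ.orthogonalProjectionOnto F = 0 := by
    refine ha.eq_zero_of_proj_s11 hGC hN (N := N) ?_ ?_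
    · rw [Submodule.coe_sub, coe_proj_orthogonal_eq_add hGC hN, coe_proj_orthogonal_eq_add hGC hN,
        hE.proj_eq, hF.proj_eq, add_sub_add_left_eq_sub, ← Submodule.coe_sub]
      exact Subtype.property _
    · rw [← sub_sub_sub_cancel_right _ _ (⟨x, hNG x.2⟩ : Gᗮ), map_sub, Submodule.coe_sub, map_sub,
        h1, h2, sub_self]
  rw [← coe_proj_add_coe_proj_orthogonal (H0 := G) E,
    ← coe_proj_add_coe_proj_orthogonal (H0 := G) F, proj_eq_schur ha.isUnit_block E,
    proj_eq_schur ha.isUnit_block F, hE.proj_apply, hF.proj_apply, sub_eq_zero.1 h3]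

end Solution

section Convergence

variable {𝕜 X : Type*} [RCLike 𝕜]
  [NormedAddCommGroup X] [InnerProductSpace 𝕜 X] [CompleteSpace X]
  {G C N : Submodule 𝕜 X} [CompleteSpace G] [CompleteSpace C] [CompleteSpace N]

/-- Continuity of the solution operator of the div-curl system under bounded convergence of the
Schur components.  The `N`-component of `E_n` solves a linear system in the finite-dimensional space
`N`, whose matrices converge; hence the `Gᗮ`-component of `E_n` converges in norm.  The remaining
components of `E_n` and of the flux depend on norm convergent data through weakly convergent
operators, and in the energy each of them is paired with a norm convergent factor. -/
theorem exists_solvesFor_of_tendsto [FiniteDimensional 𝕜 N] (hGC : C ≤ Gᗮ) (hN : N = Gᗮ ⊓ Cᗮ)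
    {a : ℕ → X →L[𝕜] X} {a' : X →L[𝕜] X}
    (ha : ∀ n, AdmissibleFor G C (a n)) (ha' : AdmissibleFor G C a')
    (hconv : Tendsto (fun n => (⟨a n, (ha n).isUnit_block, (ha n).isUnit⟩ : MSet G)) atTop
      (@nhds _ (tauB G) ⟨a', ha'.isUnit_block, ha'.isUnit⟩))
    {d : ℕ → G} {d' : G} (hd : Tendsto d atTop (𝓝 d'))
    {k : ℕ → C} {k' : C} (hk : Tendsto k atTop (𝓝 k'))
    {x : ℕ → N} {x' : N} (hx : Tendsto x atTop (𝓝 x'))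
    {E : ℕ → X} (hE : ∀ n, SolvesFor (ha n) hGC (d n) (k n) (x n) (E n)) :
    ∃ E' : X, SolvesFor ha' hGC d' k' x' E' ∧ WeaklyTendsto (𝕜 := 𝕜) E E' ∧
      WeaklyTendsto (𝕜 := 𝕜) (fun n => a n (E n)) (a' E') ∧
      Tendsto (fun n => inner 𝕜 (a n (E n)) (E n)) atTop (𝓝 (inner 𝕜 (a' E') E')) := by
  have hNG : N ≤ Gᗮ := hN ▸ inf_le_left
  have hNC : N ≤ Cᗮ := hN ▸ inf_le_right
  obtain ⟨r, hr⟩ := exists_eventually_mem_MBall hconv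
  have hS := tendsto_schurMap hconv
  have t00 : Tendsto (fun n => ContinuousLinearMapWOT.ofCLM (s00 G (a n))) atTop
      (𝓝 (ContinuousLinearMapWOT.ofCLM (s00 G a'))) := hS.fst_nhds
  have t01 : Tendsto (fun n => ContinuousLinearMapWOT.ofCLM (s01 G (a n))) atTop
      (𝓝 (ContinuousLinearMapWOT.ofCLM (s01 G a'))) := hS.snd_nhds.fst_nhds
  have t10 : Tendsto (fun n => ContinuousLinearMapWOT.ofCLM (s10 G (a n))) atTop
      (𝓝 (ContinuousLinearMapWOT.ofCLM (s10 G a'))) := hS.snd_nhds.snd_nhds.fst_nhds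
  have t11 : Tendsto (fun n => ContinuousLinearMapWOT.ofCLM (s11 G (a n))) atTop
      (𝓝 (ContinuousLinearMapWOT.ofCLM (s11 G a'))) := hS.snd_nhds.snd_nhds.snd_nhds
  have b00 : ∀ᶠ n in atTop, ‖s00 G (a n)‖ ≤ r := hr.mono fun n h => h.1
  have b01 : ∀ᶠ n in atTop, ‖s01 G (a n)‖ ≤ r := hr.mono fun n h => h.2.1
  have b10 : ∀ᶠ n in atTop, ‖s10 G (a n)‖ ≤ r := hr.mono fun n h => h.2.2.1
  have b11 : ∀ᶠ n in atTop, ‖s11 G (a n)‖ ≤ r := hr.mono fun n h => h.2.2.2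
  -- the inclusions of `N` and `C` into `Gᗮ`, and the projection of `Gᗮ` onto `N`
  let jN : N →L[𝕜] Gᗮ := N.subtypeL.codRestrict Gᗮ fun z => hNG z.2
  let jC : C →L[𝕜] Gᗮ := C.subtypeL.codRestrict Gᗮ fun z => hGC z.2
  let p : Gᗮ →L[𝕜] N := N.orthogonalProjectionOnto.comp Gᗮ.subtypeL
  have hQ : ∀ n, Gᗮ.orthogonalProjectionOnto (E n)
      = jC (k n) + jN (N.orthogonalProjectionOnto (E n)) := fun n => Subtype.ext <| by
    rw [coe_proj_orthogonal_eq_add hGC hN, (hE n).proj_eq]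
    rfl
  -- the finite-dimensional system for the `N`-components
  have hsys : ∀ n, (p.comp ((s11 G (a n)).comp jN)) (N.orthogonalProjectionOnto (E n) - x n)
      = -p (s11 G (a n) (jC (k n))) := fun n => by
    have h1 : p (s11 G (a n) (Gᗮ.orthogonalProjectionOnto (E n) - jN (x n))) = 0 :=
      ((ha n).proj_projection_eq_iff hGC hN (E n) (x n) (jN (x n)) rfl).1 (hE n).proj_projection
    rw [hQ, add_sub_assoc, ← map_sub, map_add, map_add] at h1
    exact eq_neg_of_add_eq_zero_right h1
  obtain ⟨y', hy', hy⟩ := exists_tendsto_solution (M := fun n => p.comp ((s11 G (a n)).comp jN))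
    (M' := p.comp ((s11 G a').comp jN))
    (fun z => ((WeaklyTendsto.of_WOT t11 b11 tendsto_const_nhds).map p).tendsto)
    (fun z hz => Subtype.ext (congrArg (Subtype.val : Gᗮ → X)
      (ha'.eq_zero_of_proj_s11 hGC hN (z := jN z) z.2 hz)))
    hsys ((WeaklyTendsto.of_WOT t11 b11 ((jC.continuous.tendsto _).comp hk)).map p).tendsto.neg
  let q' : Gᗮ := jC k' + jN (y' + x')
  have hq : Tendsto (fun n => Gᗮ.orthogonalProjectionOnto (E n)) atTop (𝓝 q') := by
    have h1 := ((jC.continuous.tendsto _).comp hk).add ((jN.continuous.tendsto _).comp (hy.add hx))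
    refine h1.congr fun n => ?_
    rw [hQ n]
    simp
  let v' : G := s00 G a' d' - s01 G a' q'
  let E' : X := v' + q'
  have hPE' : G.orthogonalProjectionOnto E' = v' := proj_coe_add_coe v' q'
  have hQE' : Gᗮ.orthogonalProjectionOnto E' = q' := proj_orthogonal_coe_add_coe v' q'
  have hPaE' : G.orthogonalProjectionOnto (a' E') = d' := proj_apply_of_schur ha'.isUnit_block d' q'
  have hQaE' : Gᗮ.orthogonalProjectionOnto (a' E') = s10 G a' d' + s11 G a' q' := by
    rw [proj_orthogonal_apply_eq_schur ha'.isUnit_block, hPaE', hQE']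
  have hv : WeaklyTendsto (𝕜 := 𝕜) (fun n => G.orthogonalProjectionOnto (E n)) v' := by
    have h1 := (WeaklyTendsto.of_WOT t00 b00 hd).sub (WeaklyTendsto.of_WOT t01 b01 hq)
    refine fun φ => (h1 φ).congr fun n => ?_
    beta_reduce
    rw [proj_eq_schur (ha n).isUnit_block (E n), (hE n).proj_apply]
  have hw : WeaklyTendsto (𝕜 := 𝕜) (fun n => Gᗮ.orthogonalProjectionOnto (a n (E n)))
      (s10 G a' d' + s11 G a' q') := by
    have h1 := (WeaklyTendsto.of_WOT t10 b10 hd).add (WeaklyTendsto.of_WOT t11 b11 hq)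
    refine fun φ => (h1 φ).congr fun n => ?_
    beta_reduce
    rw [proj_orthogonal_apply_eq_schur (ha n).isUnit_block (E n), (hE n).proj_apply]
  have hvb : ∃ R : ℝ, ∀ᶠ n in atTop, ‖G.orthogonalProjectionOnto (E n)‖ ≤ R := by
    obtain ⟨R1, h1⟩ := exists_eventually_norm_apply_le b00 hd
    obtain ⟨R2, h2⟩ := exists_eventually_norm_apply_le b01 hq
    refine ⟨R1 + R2, (h1.and h2).mono fun n h => ?_⟩
    rw [proj_eq_schur (ha n).isUnit_block (E n), (hE n).proj_apply]
    exact (norm_sub_le _ _).trans (add_le_add h.1 h.2)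
  have hwb : ∃ R : ℝ, ∀ᶠ n in atTop, ‖Gᗮ.orthogonalProjectionOnto (a n (E n))‖ ≤ R := by
    obtain ⟨R1, h1⟩ := exists_eventually_norm_apply_le b10 hd
    obtain ⟨R2, h2⟩ := exists_eventually_norm_apply_le b11 hq
    refine ⟨R1 + R2, (h1.and h2).mono fun n h => ?_⟩
    rw [proj_orthogonal_apply_eq_schur (ha n).isUnit_block (E n), (hE n).proj_apply]
    exact (norm_add_le _ _).trans (add_le_add h.1 h.2)
  have hinner : ∀ u w : X, inner 𝕜 u w
      = inner 𝕜 (G.orthogonalProjectionOnto u) (G.orthogonalProjectionOnto w)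
        + inner 𝕜 (Gᗮ.orthogonalProjectionOnto u) (Gᗮ.orthogonalProjectionOnto w) := fun u w => by
    conv_lhs => rw [← coe_proj_add_coe_proj_orthogonal (H0 := G) u, inner_add_left]
    rw [Submodule.inner_orthogonalProjectionOnto_eq_of_mem_left,
      Submodule.inner_orthogonalProjectionOnto_eq_of_mem_left]
  refine ⟨E', ⟨hPaE', ?_, ?_⟩, ?_, ?_, ?_⟩
  · have h1 : C.orthogonalProjectionOnto (v' : X) = 0 :=
      proj_eq_zero_of_mem_orthogonal (le_orthogonal_symm hGC v'.2)
    have h2 : C.orthogonalProjectionOnto ((y' + x' : N) : X) = 0 :=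
      proj_eq_zero_of_mem_orthogonal (hNC (y' + x').2)
    change C.orthogonalProjectionOnto ((v' : X) + ((k' : X) + ((y' + x' : N) : X))) = k'
    rw [map_add, map_add, h1, h2, Submodule.orthogonalProjectionOnto_mem_subspace_eq_self, zero_add,
      add_zero]
  · refine (ha'.proj_projection_eq_iff hGC hN E' x' (jN x') rfl).2 ?_
    change p (s11 G a' _) = 0
    have h1 : Gᗮ.orthogonalProjectionOnto E' - jN x' = jC k' + jN y' := by
      rw [hQE']
      simp only [q', map_add]
      abel
    have h2 : p (s11 G a' (jN y')) = -p (s11 G a' (jC k')) :=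
      tendsto_nhds_unique (tendsto_const_nhds (f := (atTop : Filter ℕ)))
        (hy' ▸ tendsto_const_nhds)
    rw [h1, map_add, map_add, h2, add_neg_cancel]
  · have h1 := (hv.map G.subtypeL).add ((WeaklyTendsto.of_tendsto hq).map Gᗮ.subtypeL)
    exact fun φ => (h1 φ).congr fun n => by
      congr 1
      exact coe_proj_add_coe_proj_orthogonal (H0 := G) (E n)
  · have h1 := ((WeaklyTendsto.of_tendsto hd).map G.subtypeL).add (hw.map Gᗮ.subtypeL)
    intro φ
    have h2 : a' E' = (d' : X) + (s10 G a' d' + s11 G a' q' : Gᗮ) := by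
      rw [← hQaE', ← hPaE']
      exact (coe_proj_add_coe_proj_orthogonal (H0 := G) (a' E')).symm
    rw [h2]
    refine (h1 φ).congr fun n => ?_
    congr 1
    have h3 := coe_proj_add_coe_proj_orthogonal (H0 := G) (a n (E n))
    rwa [(hE n).proj_apply] at h3
  · obtain ⟨R1, h1⟩ := hvb
    obtain ⟨R2, h2⟩ := hwb
    have h3 := (tendsto_inner_of_weaklyTendsto hd hv h1).add
      (tendsto_inner_of_weaklyTendsto' hw h2 hq)
    rw [hinner, hPaE', hQaE', hPE', hQE']
    refine h3.congr fun n => ?_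
    rw [hinner (a n (E n)), (hE n).proj_apply]

end Convergence

/-! ### The complex property and the consequences of electric compactness -/

section Concrete

variable {𝕜 : Type*} [RCLike 𝕜] {Ω : Opens R3}

theorem pd_pd_comm {u : R3 → 𝕜} (hu : ContDiff ℝ (⊤ : ℕ∞) u) (i j : Fin 3) (x : R3) :
    pd i (pd j u) x = pd j (pd i u) x := by
  have h1 : ∀ i j, pd i (pd j u) x = fderiv ℝ (fderiv ℝ u) x (e i) (e j) := fun i j => by
    have hd : DifferentiableAt ℝ (fderiv ℝ u) x :=
      ((hu.fderiv_right (m := ((⊤ : ℕ∞) : WithTop ℕ∞)) (by simp)).differentiable (by simp)) x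
    change fderiv ℝ (fun y => fderiv ℝ u y (e j)) x (e i) = _
    rw [fderiv_clm_apply hd (differentiableAt_const _)]
    simp
  have hs : IsSymmSndFDerivAt ℝ u x :=
    hu.contDiffAt.isSymmSndFDerivAt (by
      rw [minSmoothness_of_isRCLikeNormedField]
      exact WithTop.coe_le_coe.2 (le_top : (2 : ℕ∞) ≤ ⊤))
  rw [h1, h1, hs.eq]

theorem curlTest_gradTest (u : 𝓓(Ω, 𝕜)) : curlTest (gradTest u) = 0 := by
  ext x i
  have h : curlFun (gradFun (u : R3 → 𝕜)) x = 0 := by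
    have hc : ∀ i j, pd i (pd j (u : R3 → 𝕜)) x = pd j (pd i (u : R3 → 𝕜)) x := fun i j =>
      pd_pd_comm u.contDiff i j x
    have h0 : (fun y => gradFun (u : R3 → 𝕜) y 0) = pd 0 u := rfl
    have h1 : (fun y => gradFun (u : R3 → 𝕜) y 1) = pd 1 u := rfl
    have h2 : (fun y => gradFun (u : R3 → 𝕜) y 2) = pd 2 u := rfl
    rw [curlFun, h0, h1, h2, hc 1 2, hc 2 0, hc 0 1]
    ext i
    fin_cases i <;> simp
  exact congrArg (fun v : Vec 𝕜 => v i) h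

variable (𝕜 Ω)

theorem isClosed_grad0 : (grad0 𝕜 Ω).IsClosed := (gradC_isClosable 𝕜 Ω).closure_isClosed

theorem dense_curlC : Dense ((curlC 𝕜 Ω).domain : Set (L2V 𝕜 Ω)) :=
  dense_testOp (𝕜 := 𝕜) (Ω := Ω) curlTest

theorem isClosed_curl : (curl 𝕜 Ω).IsClosed := LinearPMap.adjoint_isClosed (dense_curlC 𝕜 Ω)

theorem isClosed_curl0 : (curl0 𝕜 Ω).IsClosed := LinearPMap.adjoint_isClosed (dense_curl 𝕜 Ω)

/-- `curl grad = 0`, in the form that rotations are orthogonal to gradients of functions in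
`H¹₀(Ω)`. -/
theorem clRanCurl_le : clRanCurl 𝕜 Ω ≤ (clRanGrad 𝕜 Ω)ᗮ := by
  refine Submodule.topologicalClosure_minimal _ ?_ (Submodule.isClosed_orthogonal _)
  rw [clRanGrad, Submodule.orthogonal_closure]
  rintro _ ⟨v, rfl⟩
  rw [Submodule.mem_orthogonal']
  rintro _ ⟨w, rfl⟩
  -- gradients of test functions are annihilated, and the gradient on `H¹₀` is their closure
  have hg : ((w : L2S 𝕜 Ω), grad0 𝕜 Ω w) ∈ (gradC 𝕜 Ω).graph.topologicalClosure := by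
    rw [(gradC_isClosable 𝕜 Ω).graph_closure_eq_closure_graph]
    exact LinearPMap.mem_graph _ w
  have hcl : IsClosed {p : L2S 𝕜 Ω × L2V 𝕜 Ω | inner 𝕜 (curl 𝕜 Ω v) p.2 = 0} :=
    isClosed_eq (continuous_const.inner continuous_snd) continuous_const
  refine closure_minimal ?_ hcl hg
  rintro p hp
  obtain ⟨⟨_, u, rfl⟩, -, hu⟩ := LinearPMap.mem_graph_iff _ |>.1 hp
  have h0 : gradC 𝕜 Ω ⟨testToL2 u, ⟨u, rfl⟩⟩ = testToL2 (𝕜 := 𝕜) (gradTest u) :=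
    testOp_apply (𝕜 := 𝕜) (gradTest (𝕜 := 𝕜) (Ω := Ω)) u
  have h1 : p.2 = testToL2 (𝕜 := 𝕜) (gradTest u) := hu.symm.trans h0
  have h3 : curlC 𝕜 Ω ⟨testToL2 (gradTest u), ⟨gradTest u, rfl⟩⟩ = 0 := by
    have := testOp_apply (𝕜 := 𝕜) (curlTest (𝕜 := 𝕜) (Ω := Ω)) (gradTest u)
    rw [curlTest_gradTest, map_zero] at this
    exact this
  have h2 := LinearPMap.adjoint_isFormalAdjoint (dense_curlC 𝕜 Ω) v
    ⟨testToL2 (gradTest u), ⟨gradTest u, rfl⟩⟩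
  rw [h3, inner_zero_right] at h2
  change inner 𝕜 _ p.2 = 0
  rw [h1]
  exact h2

theorem ker_dive : ker (dive 𝕜 Ω) = (clRanGrad 𝕜 Ω)ᗮ := by
  rw [clRanGrad, Submodule.orthogonal_closure, ← ker_adjoint (dense_grad0 𝕜 Ω)]
  ext x
  simp only [mem_ker, dive, LinearPMap.neg_apply, neg_eq_zero]
  rfl

theorem ker_curl0 : ker (curl0 𝕜 Ω) = (clRanCurl 𝕜 Ω)ᗮ := by
  rw [clRanCurl, Submodule.orthogonal_closure, curl0, ker_adjoint (dense_curl 𝕜 Ω)]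

theorem HD_eq_inf : HD 𝕜 Ω = (clRanGrad 𝕜 Ω)ᗮ ⊓ (clRanCurl 𝕜 Ω)ᗮ := by
  rw [HD, ker_dive, ker_curl0]

variable {𝕜 Ω}

/-- The unit ball of the graph norm on gradients consists of fields with vanishing rotation, so that
electric compactness yields a Poincaré estimate for the divergence on gradients, and hence bounded
preimages under the gradient. -/
theorem ElectricCompactness.exists_preimage_grad (hΩ : ElectricCompactness 𝕜 Ω) :
    ∃ c : ℝ, 0 ≤ c ∧ ∀ y ∈ clRanGrad 𝕜 Ω, ∃ u : (grad0 𝕜 Ω).domain,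
      grad0 𝕜 Ω u = y ∧ ‖(u : L2S 𝕜 Ω)‖ ≤ c * ‖y‖ := by
  have hle : clRanGrad 𝕜 Ω ≤ ker (curl0 𝕜 Ω) := by
    rw [ker_curl0]
    exact le_orthogonal_symm (clRanCurl_le 𝕜 Ω)
  obtain ⟨c, hc, hest⟩ := exists_estimate_of_isCompact
    (LinearPMap.adjoint_isClosed (dense_grad0 𝕜 Ω)) (V := clRanGrad 𝕜 Ω)
    (Submodule.isClosed_topologicalClosure _)
    (fun y h1 h2 => by
      rw [ker_adjoint (dense_grad0 𝕜 Ω), ← Submodule.orthogonal_closure] at h2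
      exact eq_zero_of_mem_of_mem_orthogonal h1 h2) hΩ
    (fun z hz hn => by
      obtain ⟨h1, h2⟩ := mem_ker.1 (hle hz)
      refine subset_closure ⟨z.2, h1, ?_⟩
      have h3 : dive 𝕜 Ω ⟨z, z.2⟩ = -(grad0 𝕜 Ω)† z := rfl
      rw [h2, h3, norm_neg, norm_zero]
      simpa using hn)
  exact ⟨c, hc, fun y hy => exists_preimage_of_adjoint_estimate (dense_grad0 𝕜 Ω)
    (isClosed_grad0 𝕜 Ω) hc hest hy⟩

/-- The unit ball of the graph norm on rotations consists of fields with vanishing divergence, so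
that electric compactness yields a Poincaré estimate for the rotation on rotations, and hence
bounded preimages under the rotation. -/
theorem ElectricCompactness.exists_preimage_curl (hΩ : ElectricCompactness 𝕜 Ω) :
    ∃ c : ℝ, 0 ≤ c ∧ ∀ y ∈ clRanCurl 𝕜 Ω, ∃ u : (curl 𝕜 Ω).domain,
      curl 𝕜 Ω u = y ∧ ‖(u : L2V 𝕜 Ω)‖ ≤ c * ‖y‖ := by
  have hle : clRanCurl 𝕜 Ω ≤ ker (dive 𝕜 Ω) := by
    rw [ker_dive]
    exact clRanCurl_le 𝕜 Ω
  obtain ⟨c, hc, hest⟩ := exists_estimate_of_isCompact (isClosed_curl0 𝕜 Ω) (V := clRanCurl 𝕜 Ω)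
    (Submodule.isClosed_topologicalClosure _)
    (fun y h1 h2 => by
      rw [ker_curl0] at h2
      exact eq_zero_of_mem_of_mem_orthogonal h1 h2) hΩ
    (fun z hz hn => by
      obtain ⟨h1, h2⟩ := mem_ker.1 (hle hz)
      refine subset_closure ⟨h1, z.2, ?_⟩
      rw [h2, norm_zero]
      simpa using hn)
  exact ⟨c, hc, fun y hy => exists_preimage_of_adjoint_estimate (dense_curl 𝕜 Ω)
    (isClosed_curl 𝕜 Ω) hc hest hy⟩

theorem ElectricCompactness.ran_grad0 (hΩ : ElectricCompactness 𝕜 Ω) :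
    ran (grad0 𝕜 Ω) = clRanGrad 𝕜 Ω := by
  obtain ⟨c, -, h⟩ := hΩ.exists_preimage_grad
  refine le_antisymm (Submodule.le_topologicalClosure _) fun y hy => ?_
  obtain ⟨u, hu, -⟩ := h y hy
  exact mem_ran.2 ⟨u, hu⟩

theorem ElectricCompactness.ran_curl (hΩ : ElectricCompactness 𝕜 Ω) :
    ran (curl 𝕜 Ω) = clRanCurl 𝕜 Ω := by
  obtain ⟨c, -, h⟩ := hΩ.exists_preimage_curl
  refine le_antisymm (Submodule.le_topologicalClosure _) fun y hy => ?_
  obtain ⟨u, hu, -⟩ := h y hy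
  exact mem_ran.2 ⟨u, hu⟩

/-- On harmonic fields the graph norm is the `L₂`-norm, so their unit ball is compact. -/
theorem ElectricCompactness.finiteDimensional_HD (hΩ : ElectricCompactness 𝕜 Ω) :
    FiniteDimensional 𝕜 (HD 𝕜 Ω) := by
  refine FiniteDimensional.of_isCompact_closedBall₀ 𝕜 (r := 1) one_pos ?_
  have hcl : IsClosed (HD 𝕜 Ω : Set (L2V 𝕜 Ω)) := by
    rw [HD_eq]
    exact (Submodule.isClosed_orthogonal _).inter (Submodule.isClosed_orthogonal _)
  refine (hcl.isClosedEmbedding_subtypeVal.isCompact_preimage hΩ).of_isClosed_subset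
    Metric.isClosed_closedBall fun z hz => subset_closure ?_
  obtain ⟨h1, h2⟩ := mem_ker.1 z.2.1
  obtain ⟨h3, h4⟩ := mem_ker.1 z.2.2
  refine ⟨h1, h3, ?_⟩
  have hz1 : ‖(z : L2V 𝕜 Ω)‖ ≤ 1 := mem_closedBall_zero_iff.1 hz
  rw [h2, h4, norm_zero, norm_zero]
  nlinarith [norm_nonneg (z : L2V 𝕜 Ω)]

/-- The distributional divergence controls the component in the gradients. -/
theorem ElectricCompactness.exists_norm_le_diamond_grad0 (hΩ : ElectricCompactness 𝕜 Ω) :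
    ∃ c : ℝ, ∀ Φ : L2V 𝕜 Ω,
      ‖(clRanGrad 𝕜 Ω).starProjection Φ‖ ≤ c * ‖diamond (grad0 𝕜 Ω) Φ‖ := by
  obtain ⟨c, hc, h⟩ := hΩ.exists_preimage_grad
  exact ⟨1 + c, norm_starProjection_le_diamond hc h⟩

/-- The distributional rotation controls the component in the rotations. -/
theorem ElectricCompactness.exists_norm_le_diamond_curlRed (hΩ : ElectricCompactness 𝕜 Ω) :
    ∃ c : ℝ, ∀ Φ : L2V 𝕜 Ω,
      ‖(clRanCurl 𝕜 Ω).starProjection Φ‖ ≤ c * ‖diamond (curlRed 𝕜 Ω) Φ‖ := by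
  obtain ⟨c, hc, h⟩ := hΩ.exists_preimage_curl
  have hk : IsClosed (ker (curl 𝕜 Ω) : Set (L2V 𝕜 Ω)) := by
    rw [curl, ker_adjoint (dense_curlC 𝕜 Ω)]
    exact Submodule.isClosed_orthogonal _
  have hred : ∀ y ∈ clRanCurl 𝕜 Ω, ∃ u : (curlRed 𝕜 Ω).domain,
      curlRed 𝕜 Ω u = y ∧ ‖(u : L2V 𝕜 Ω)‖ ≤ c * ‖y‖ := fun y hy =>
    exists_preimage_reduced hk (h y hy)
  exact ⟨1 + c, norm_starProjection_le_diamond hc hred⟩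

theorem ran_curlRed_le : ran (curlRed 𝕜 Ω) ≤ clRanCurl 𝕜 Ω :=
  (ran_reduced_le _).trans (Submodule.le_topologicalClosure _)

theorem ran_grad0_le : ran (grad0 𝕜 Ω) ≤ clRanGrad 𝕜 Ω := Submodule.le_topologicalClosure _

/-- Limits in `H⁻¹(Ω)` of distributional divergences are again divergences of gradients, and the
components in the gradients converge. -/
theorem ElectricCompactness.exists_tendsto_of_divD (hΩ : ElectricCompactness 𝕜 Ω)
    {Φ : ℕ → L2V 𝕜 Ω} {f : HnegGrad 𝕜 Ω}
    (hf : Tendsto (fun n => divD 𝕜 Ω (Φ n)) atTop (𝓝 f)) :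
    ∃ d : clRanGrad 𝕜 Ω, divD 𝕜 Ω d = f ∧
      Tendsto (fun n => (clRanGrad 𝕜 Ω).orthogonalProjectionOnto (Φ n)) atTop (𝓝 d) := by
  obtain ⟨c, hc⟩ := hΩ.exists_norm_le_diamond_grad0
  have hf₁ : Tendsto (fun n => diamond (grad0 𝕜 Ω) (Φ n)) atTop (𝓝 (-f)) :=
    hf.neg.congr fun n => by rw [divD, neg_neg]
  obtain ⟨d, hdG, hdf, hd⟩ := exists_tendsto_starProjection_of_diamond ran_grad0_le hc hf₁
  refine ⟨⟨d, hdG⟩, ?_, tendsto_subtype_rng.2 hd⟩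
  rw [divD, hdf, neg_neg]

/-- Limits in `H⁻¹(curl_red)` of distributional rotations are again of this form, and the components
in the rotations converge. -/
theorem ElectricCompactness.exists_tendsto_of_curlD (hΩ : ElectricCompactness 𝕜 Ω)
    {Φ : ℕ → L2V 𝕜 Ω} {g : HnegCurl 𝕜 Ω}
    (hg : Tendsto (fun n => curlD 𝕜 Ω (Φ n)) atTop (𝓝 g)) :
    ∃ k : clRanCurl 𝕜 Ω, curlD 𝕜 Ω k = g ∧
      Tendsto (fun n => (clRanCurl 𝕜 Ω).orthogonalProjectionOnto (Φ n)) atTop (𝓝 k) := by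
  obtain ⟨c, hc⟩ := hΩ.exists_norm_le_diamond_curlRed
  obtain ⟨k, hkC, hkg, hk⟩ := exists_tendsto_starProjection_of_diamond ran_curlRed_le hc hg
  exact ⟨⟨k, hkC⟩, hkg, tendsto_subtype_rng.2 hk⟩

theorem divD_orthogonalProjectionOnto (Φ : L2V 𝕜 Ω) :
    divD 𝕜 Ω ((clRanGrad 𝕜 Ω).orthogonalProjectionOnto Φ) = divD 𝕜 Ω Φ :=
  congrArg (fun F : HnegGrad 𝕜 Ω => -F) (diamond_starProjection ran_grad0_le Φ)

theorem curlD_orthogonalProjectionOnto (Φ : L2V 𝕜 Ω) :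
    curlD 𝕜 Ω ((clRanCurl 𝕜 Ω).orthogonalProjectionOnto Φ) = curlD 𝕜 Ω Φ :=
  diamond_starProjection ran_curlRed_le Φ

/-! ### The electrostatic system as an abstract div-curl system -/

theorem Admissible.admissibleFor {ε : L2V 𝕜 Ω →L[𝕜] L2V 𝕜 Ω} (h : Admissible ε) :
    AdmissibleFor (clRanGrad 𝕜 Ω) (clRanCurl 𝕜 Ω) ε := ⟨h.a1, h.a2, h.a3⟩

/-- Under electric compactness `π_ε` is the projection of the direct decomposition, so the default
value in its definition does not occur. -/
theorem Admissible.piEps_eq {ε : L2V 𝕜 Ω →L[𝕜] L2V 𝕜 Ω} (h : Admissible ε)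
    (hΩ : ElectricCompactness 𝕜 Ω) :
    piEps ε = (harmonic (clRanGrad 𝕜 Ω) (clRanCurl 𝕜 Ω) ε).projection
      (potential (clRanGrad 𝕜 Ω) (clRanCurl 𝕜 Ω) ε)
      (h.admissibleFor.isCompl (clRanCurl_le 𝕜 Ω)) := by
  have h1 : Heps ε = harmonic (clRanGrad 𝕜 Ω) (clRanCurl 𝕜 Ω) ε := by
    rw [Heps, ker_dive, ker_curl0, harmonic]
  have h2 : ran (grad0 𝕜 Ω) ⊔ (ran (curl 𝕜 Ω)).map (Ring.inverse ε).toLinearMap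
      = potential (clRanGrad 𝕜 Ω) (clRanCurl 𝕜 Ω) ε := by
    rw [hΩ.ran_grad0, hΩ.ran_curl, potential]
  have h3 : IsCompl (Heps ε)
      (ran (grad0 𝕜 Ω) ⊔ (ran (curl 𝕜 Ω)).map (Ring.inverse ε).toLinearMap) := by
    rw [h1, h2]
    exact h.admissibleFor.isCompl (clRanCurl_le 𝕜 Ω)
  rw [piEps, dif_pos h3]
  congr 1

/-- The right-hand sides `f`, `g` correspond to components `d` of the flux in the gradients and `k`
of the field in the rotations. -/
theorem Admissible.solves_iff {ε : L2V 𝕜 Ω →L[𝕜] L2V 𝕜 Ω} (h : Admissible ε)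
    (hΩ : ElectricCompactness 𝕜 Ω) {f : HnegGrad 𝕜 Ω} {g : HnegCurl 𝕜 Ω} {x : HD 𝕜 Ω}
    {d : clRanGrad 𝕜 Ω} (hd : divD 𝕜 Ω d = f) {k : clRanCurl 𝕜 Ω} (hk : curlD 𝕜 Ω k = g)
    {E : L2V 𝕜 Ω} :
    Solves ε f g x E ↔ SolvesFor h.admissibleFor (clRanCurl_le 𝕜 Ω) d k x E := by
  obtain ⟨c₁, hc₁⟩ := hΩ.exists_norm_le_diamond_grad0
  obtain ⟨c₂, hc₂⟩ := hΩ.exists_norm_le_diamond_curlRed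
  constructor
  · rintro ⟨h1, h2, h3⟩
    refine ⟨Subtype.ext ?_, Subtype.ext ?_, ?_⟩
    · have h4 : diamond (grad0 𝕜 Ω) (ε E) = diamond (grad0 𝕜 Ω) d := neg_inj.1 (h1.trans hd.symm)
      have h5 := hc₁ (ε E - d)
      rw [diamond_sub, h4, sub_self, map_sub, Submodule.starProjection_eq_self_iff.2 d.2] at h5
      have h6 : ‖(0 : HnegGrad 𝕜 Ω)‖ = 0 := norm_zero (E := HnegGrad 𝕜 Ω)
      rw [h6, mul_zero] at h5
      exact sub_eq_zero.1 (norm_le_zero_iff.1 h5)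
    · have h4 : diamond (curlRed 𝕜 Ω) E = diamond (curlRed 𝕜 Ω) k := h2.trans hk.symm
      have h5 := hc₂ (E - k)
      rw [diamond_sub, h4, sub_self, map_sub, Submodule.starProjection_eq_self_iff.2 k.2] at h5
      have h6 : ‖(0 : HnegCurl 𝕜 Ω)‖ = 0 := norm_zero (E := HnegCurl 𝕜 Ω)
      rw [h6, mul_zero] at h5
      exact sub_eq_zero.1 (norm_le_zero_iff.1 h5)
    · rw [← h.piEps_eq hΩ]
      exact h3
  · rintro ⟨h1, h2, h3⟩
    refine ⟨?_, ?_, ?_⟩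
    · rw [← hd, ← divD_orthogonalProjectionOnto, h1]
    · rw [← hk, ← curlD_orthogonalProjectionOnto, h2]
    · rw [h.piEps_eq hΩ]
      exact h3

end Concrete

end Electro

theorem theoremB {𝕜 : Type*} [RCLike 𝕜] (Ω : TopologicalSpace.Opens Electro.R3)
    (hΩ : Electro.ElectricCompactness 𝕜 Ω)
    (ε : ℕ → Electro.L2V 𝕜 Ω →L[𝕜] Electro.L2V 𝕜 Ω) (ε' : Electro.L2V 𝕜 Ω →L[𝕜] Electro.L2V 𝕜 Ω)
    (hε : ∀ n, Electro.Admissible (ε n)) (hε' : Electro.Admissible ε')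
    (hconv : Electro.ConvBH ε ε' hε hε')
    (f : ℕ → Electro.HnegGrad 𝕜 Ω) (f' : Electro.HnegGrad 𝕜 Ω)
    (hf : Filter.Tendsto f Filter.atTop (nhds f'))
    (g : ℕ → Electro.HnegCurl 𝕜 Ω) (g' : Electro.HnegCurl 𝕜 Ω)
    (hg : Filter.Tendsto g Filter.atTop (nhds g'))
    (x : ℕ → Electro.HD 𝕜 Ω) (x' : Electro.HD 𝕜 Ω)
    (hx : Filter.Tendsto x Filter.atTop (nhds x'))
    (E : ℕ → Electro.L2V 𝕜 Ω) (hE : ∀ n, Electro.Solves (ε n) (f n) (g n) (x n) (E n)) :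
    ∃ E' : Electro.L2V 𝕜 Ω,
      Electro.Solves ε' f' g' x' E' ∧
      (∀ E'' : Electro.L2V 𝕜 Ω, Electro.Solves ε' f' g' x' E'' → E'' = E') ∧
      Electro.WeaklyTendsto (𝕜 := 𝕜) E E' ∧
      Electro.WeaklyTendsto (𝕜 := 𝕜) (fun n => ε n (E n)) (ε' E') ∧
      Filter.Tendsto (fun n => inner 𝕜 (ε n (E n)) (E n)) Filter.atTop
        (nhds (inner 𝕜 (ε' E') E')) := by
  have := hΩ.finiteDimensional_HD
  -- the limits of the data are again of the form `div d` and `curl k`, by completeness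
  obtain ⟨d, hdf, hd⟩ := hΩ.exists_tendsto_of_divD (Φ := fun n => ε n (E n))
    (hf.congr fun n => (hE n).div_eq.symm)
  obtain ⟨k, hkg, hk⟩ := hΩ.exists_tendsto_of_curlD (Φ := E)
    (hg.congr fun n => (hE n).curl_eq.symm)
  obtain ⟨E', hE', h1, h2, h3⟩ := Electro.exists_solvesFor_of_tendsto
    (Electro.clRanCurl_le 𝕜 Ω) (Electro.HD_eq_inf 𝕜 Ω) (fun n => (hε n).admissibleFor)
    hε'.admissibleFor hconv hd hk hx fun n => ((hε n).solves_iff hΩ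
      ((Electro.divD_orthogonalProjectionOnto _).trans (hE n).div_eq)
      ((Electro.curlD_orthogonalProjectionOnto _).trans (hE n).curl_eq)).1 (hE n)
  exact ⟨E', (hε'.solves_iff hΩ hdf hkg).2 hE', fun F hF =>
    ((hε'.solves_iff hΩ hdf hkg).1 hF).unique (Electro.HD_eq_inf 𝕜 Ω) hE', h1, h2, h3⟩
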